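/- Let $K$ be a field of characteristic $0$ and $X$ a $K$-vector space with dual $X^*$; write $\langle x,\lambda\rangle=\lambda(x)$. Definitions. A pre-reflection system $(R,X,s)$ consists of a spanning set $R\subset X$ with $0\in R$ and a map $s\colon R\to \mathrm{GL}(X)$, $\alpha\mapsto s_\alpha$, such that for all $\alpha\in R$: the fixed space of $s_\alpha$ has codimension $\le 1$; $s_\alpha^2=\mathrm{Id}$; if $\alpha\in R^{\rm re}:=\{\beta\in R: s_\beta\ne \mathrm{Id}\}$ (the real roots) then $s_\alpha(\alpha)=-\alpha\neq\alpha$; and $s_\alpha$ maps $R^{\rm re}$ onto $R^{\rm re}$ and $R^{\rm im}:=\{\beta\in R: s_\beta=\mathrm{Id}\}$ onto $R^{\rm im}$. Put $\mathrm{Re}(R)=R^{\rm re}\cup\{0\}$. For $\alpha\in R^{\rm re}$, $\alpha^\vee\in X^*$ is the unique linear form with $s_\alpha(x)=x-\langle x,\alpha^\vee\rangle\alpha$ for all $x$; for $\alpha\in R^{\rm im}$, $\alpha^\vee=0$. $R$ is integral if $\langle R,\alpha^\vee\rangle\subset\mathbb Z$ for all $\alpha\in R$. The Weyl group $W(R)$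 is the group generated by all $s_\alpha$. A morphism $(R,X)\to(S,Y)$ is a linear map $f\colon X\to Y$ with $f(R)\subset S$ and $f(s_\alpha\beta)=s_{f(\alpha)}f(\beta)$ for $\alpha,\beta\in R$; it is an extension if $f(R^{\rm re})=S^{\rm re}$ and $f(R^{\rm im})=S^{\rm im}$. A locally finite root system is an integral pre-reflection system with $R=\mathrm{Re}(R)$ such that $R\cap V$ is finite for every finite-dimensional subspace $V\subset X$. An affine reflection system is a pre-reflection system $R$ that has an extension $f\colon R\to S$ onto a locally finite root system $S$; then $S$, which is unique up to a unique isomorphism compatible with the projections, is called the quotient root system of $R$ and $f$ its canonical projection. For a system $R$ that is coherent, i.e. $\langle\alpha,\beta^\vee\rangle=0\Leftrightarrow\langle\beta,\alpha^\vee\rangle=0$ for $\alpha,\beta\in R^{\rm re}$ (every affine reflection system is), two real roots $\alpha,\beta$ are connected if there are roots $\alpha=\alpha_0,\dots,\alpha_n=\beta$ with $\langle\alpha_i,\alpha_{i-1}^\vee\rangle\neq0$ for $1\le i\le n$; a connected component of $\mathrm{Re}(R)$ is the union of $\{0\}$ and a class of connected real roots, and $\mathrm{Re}(R)$ is connected if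 it has exactly one connected component. A locally finite root system is irreducible if it has a nonzero root and is not isomorphic to a direct sum of two pre-reflection systems that both have real roots. (In a direct sum the set of roots is $R_1\cup R_2\subset X_1\oplus X_2$ and each reflection of one summand is extended by the identity on the other.) An affine form of $(R,X)$ is a $W(R)$-invariant symmetric bilinear form $b\colon X\times X\to K$ with $R^{\rm im}=R\cap\operatorname{Rad} b$, where $\operatorname{Rad}b=\{x: b(x,X)=0\}$. Theorem. Let $(R,X)$ be a pre-reflection system over $K$. Then $(R,X)$ is an affine reflection system if and only if (i) $(R,X)$ is integral, (ii) $(R,X)$ has an affine form, and (iii) $\langle R,\alpha^\vee\rangle$ is bounded, as a set of integers, for every $\alpha\in R^{\rm re}$. In this case: (a) Let $b$ be any affine form for $(R,X)$ and $f\colon X\to X/\operatorname{Rad}b$ the canonical map. Then $(f(R),X/\operatorname{Rad}b)$, with suitable reflections, is the quotient root system $S$ of $R$, with canonical projection $f$. Moreover, $\mathrm{Re}(R)$ is connected if and only if $S$ is irreducible. (b) There is a unique affine form $(\cdot|\cdot)_a$ on $(R,X)$ that is normalized, i.e. such that for every connected component $C$ of $\mathrm{Re}(R)$ $$2\in\{(\alpha|\alpha)_a: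 0\ne\alpha\in C\}\subset\{2,3,4,6,8\}.$$ It satisfies $\{(\alpha|\alpha)_a:0\neq\alpha\in C\}\in\{\{2\},\{2,4\},\{2,6\},\{2,8\},\{2,4,8\}\}$ for every such $C$. Its radical is $\operatorname{Ker}f$, where $f$ is the canonical projection of $R$ onto its quotient root system. If $K=\mathbb R$, then $(\cdot|\cdot)_a$ is positive semidefinite. -/

import Mathlib

open Module

universe u v w

/-- For a set `roots` with a map `s` into `GL(X)`: the elements `α` with `s_α ≠ Id`. -/
def realRootsOf {K : Type u} {X : Type v} [Field K] [AddCommGroup X] [Module K X]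
    (roots : Set X) (s : roots → (X ≃ₗ[K] X)) : Set X :=
  {x | ∃ h : x ∈ roots, s ⟨x, h⟩ ≠ 1}

/-- For a set `roots` with a map `s` into `GL(X)`: the elements `α` with `s_α = Id`. -/
def imRootsOf {K : Type u} {X : Type v} [Field K] [AddCommGroup X] [Module K X]
    (roots : Set X) (s : roots → (X ≃ₗ[K] X)) : Set X :=
  {x | ∃ h : x ∈ roots, s ⟨x, h⟩ = 1}

/-- A pre-reflection system `(R, X, s)` over the field `K`; here `roots` is the set `R`. -/
structure PreReflectionSystem (K : Type u) (X : Type v)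
    [Field K] [AddCommGroup X] [Module K X] where
  /-- the set `R` of roots -/
  roots : Set X
  /-- the map `α ↦ s_α` into `GL(X)` -/
  s : roots → (X ≃ₗ[K] X)
  zero_mem : (0 : X) ∈ roots
  span_roots : Submodule.span K roots = ⊤
  /-- the fixed point space of `s_α` has codimension at most one -/
  codim_fixed_le_one : ∀ α : roots,
    Module.rank K (X ⧸ LinearMap.ker ((s α : X →ₗ[K] X) - LinearMap.id)) ≤ 1
  s_mul_self : ∀ α : roots, s α * s α = 1
  s_apply_self : ∀ α : roots, s α ≠ 1 → s α (α : X) = -(α : X) ∧ -(α : X) ≠ (α : X)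
  s_image_real : ∀ α : roots, (s α) '' realRootsOf roots s = realRootsOf roots s
  s_image_im : ∀ α : roots, (s α) '' imRootsOf roots s = imRootsOf roots s

namespace PreReflectionSystem

variable {K : Type u} {X : Type v} [Field K] [AddCommGroup X] [Module K X]

/-- `R^re` -/
def realRoots (R : PreReflectionSystem K X) : Set X := realRootsOf R.roots R.s

/-- `R^im` -/
def imRoots (R : PreReflectionSystem K X) : Set X := imRootsOf R.roots R.s

/-- Each real root `α` has a linear form `φ` with `s_α x = x - φ(x) α`. -/
theorem exists_coroot (R : PreReflectionSystem K X) (α : R.roots) (hα : R.s α ≠ 1) :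
    ∃ φ : Dual K X, ∀ x : X, R.s α x = x - φ x • (α : X) := by
  obtain ⟨h1, h2⟩ := R.s_apply_self α hα
  have hα0 : (α : X) ≠ 0 := by
    intro h
    rw [h] at h2
    simp at h2
  have key : ∀ x : X, ((R.s α : X →ₗ[K] X) - (LinearMap.id : X →ₗ[K] X)) x ∈ Submodule.span K {(α : X)} := by
    intro x
    obtain ⟨v₀, hv⟩ := rank_le_one_iff.1 (R.codim_fixed_le_one α)
    obtain ⟨r₀, hr₀⟩ := hv (Submodule.Quotient.mk (α : X))
    obtain ⟨r, hr⟩ := hv (Submodule.Quotient.mk x)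
    have hne : r₀ ≠ 0 := by
      rintro rfl
      rw [zero_smul] at hr₀
      have h3 := (Submodule.Quotient.mk_eq_zero _).1 hr₀.symm
      rw [LinearMap.mem_ker] at h3
      simp only [LinearMap.sub_apply, LinearEquiv.coe_coe, LinearMap.id_apply] at h3
      rw [h1] at h3
      exact h2 (sub_eq_zero.1 h3)
    have h4 : (Submodule.Quotient.mk x :
        X ⧸ LinearMap.ker ((R.s α : X →ₗ[K] X) - LinearMap.id)) =
        Submodule.Quotient.mk ((r / r₀) • (α : X)) := by
      rw [Submodule.Quotient.mk_smul, ← hr₀, smul_smul, div_mul_cancel₀ _ hne, hr]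
    rw [Submodule.Quotient.eq, LinearMap.mem_ker, map_sub, sub_eq_zero] at h4
    rw [h4, map_smul]
    apply Submodule.smul_mem
    simp only [LinearMap.sub_apply, LinearEquiv.coe_coe, LinearMap.id_apply]
    rw [h1]
    exact Submodule.sub_mem _ (Submodule.neg_mem _ (Submodule.mem_span_singleton_self _))
      (Submodule.mem_span_singleton_self _)
  let g : X →ₗ[K] Submodule.span K {(α : X)} :=
    ((R.s α : X →ₗ[K] X) - LinearMap.id).codRestrict _ key
  let c := (LinearEquiv.toSpanNonzeroSingleton K X (α : X) hα0).symm
  refine ⟨-(c.toLinearMap ∘ₗ g), fun x => ?_⟩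
  have h5 : c (g x) • (α : X) = R.s α x - x := by
    have h6 := LinearEquiv.apply_symm_apply
      (LinearEquiv.toSpanNonzeroSingleton K X (α : X) hα0) (g x)
    have h7 := congrArg Subtype.val h6
    exact h7
  simp only [LinearMap.neg_apply, LinearMap.comp_apply, LinearEquiv.coe_coe, neg_smul]
  rw [h5]
  abel

open Classical in
/-- The coroot `α^∨ ∈ X^*`: for real `α` the linear form with `s_α x = x - ⟨x, α^∨⟩ α`
(it exists and is unique), and `0` for imaginary `α`. -/
noncomputable def coroot (R : PreReflectionSystem K X) (α : R.roots) : Dual K X :=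
  if h : R.s α ≠ 1 then (R.exists_coroot α h).choose else 0

theorem s_apply (R : PreReflectionSystem K X) (α : R.roots) (x : X) :
    R.s α x = x - R.coroot α x • (α : X) := by
  unfold coroot
  split_ifs with h
  · exact (R.exists_coroot α h).choose_spec x
  · simp only [ne_eq, not_not] at h
    simp [h]

/-- The Weyl group `W(R)`. -/
def weylGroup (R : PreReflectionSystem K X) : Subgroup (X ≃ₗ[K] X) :=
  Subgroup.closure (Set.range R.s)

/-- `⟨R, R^∨⟩ ⊆ ℤ` -/
def IsIntegral (R : PreReflectionSystem K X) : Prop :=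
  ∀ α β : R.roots, ∃ n : ℤ, R.coroot α (β : X) = (n : K)

/-- For every real root `α`, the set `⟨R, α^∨⟩` is bounded as a set of integers. -/
def HasBoundedCorootValues (R : PreReflectionSystem K X) : Prop :=
  ∀ α : R.roots, (α : X) ∈ R.realRoots →
    ∃ N : ℕ, ∀ β : R.roots, ∀ n : ℤ, R.coroot α (β : X) = (n : K) → |n| ≤ N

/-! ### Morphisms, extensions -/

/-- `f : X → Y` is a morphism `(R, X) → (S, Y)`. -/
def IsMorphism {Y : Type w} [AddCommGroup Y] [Module K Y]
    (R : PreReflectionSystem K X) (S : PreReflectionSystem K Y) (f : X →ₗ[K] Y) : Prop :=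
  ∃ h : ∀ α : R.roots, f (α : X) ∈ S.roots,
    ∀ α β : R.roots, f (R.s α (β : X)) = S.s ⟨f (α : X), h α⟩ (f (β : X))

/-- `e : X ≃ Y` is an isomorphism `(R, X) ≅ (S, Y)`. -/
def IsIsomorphism {Y : Type w} [AddCommGroup Y] [Module K Y]
    (R : PreReflectionSystem K X) (S : PreReflectionSystem K Y) (e : X ≃ₗ[K] Y) : Prop :=
  R.IsMorphism S (e : X →ₗ[K] Y) ∧ S.IsMorphism R (e.symm : Y →ₗ[K] X)

/-- `f : (R, X) → (S, Y)` is an extension. -/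
def IsExtension {Y : Type w} [AddCommGroup Y] [Module K Y]
    (R : PreReflectionSystem K X) (S : PreReflectionSystem K Y) (f : X →ₗ[K] Y) : Prop :=
  R.IsMorphism S f ∧ f '' R.imRoots = S.imRoots ∧ f '' R.realRoots = S.realRoots

/-! ### Locally finite root systems and affine reflection systems -/

/-- A locally finite root system: integral, `R = R^re ∪ {0}`, and only finitely many roots lie
in each finite-dimensional subspace. -/
def IsLocallyFiniteRootSystem (R : PreReflectionSystem K X) : Prop :=
  R.IsIntegral ∧ R.roots = R.realRoots ∪ {0} ∧
    ∀ V : Submodule K X, FiniteDimensional K V → (R.roots ∩ (V : Set X)).Finite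

/-- `(S, Y)` is the quotient root system of `R`, with canonical projection `f`. -/
def IsQuotientRootSystem {Y : Type w} [AddCommGroup Y] [Module K Y]
    (R : PreReflectionSystem K X) (S : PreReflectionSystem K Y) (f : X →ₗ[K] Y) : Prop :=
  S.IsLocallyFiniteRootSystem ∧ R.IsExtension S f

/-- An affine reflection system is an extension of a locally finite root system. An extension
`X → Y` is surjective, so it is no restriction to take `Y` in the universe of `X`. -/
def IsAffineReflectionSystem (R : PreReflectionSystem K X) : Prop :=
  ∃ (Y : Type v) (_ : AddCommGroup Y) (_ : Module K Y) (S : PreReflectionSystem K Y)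
    (f : X →ₗ[K] Y), S.IsLocallyFiniteRootSystem ∧ R.IsExtension S f

/-! ### Connectedness and irreducibility -/

/-- `α = α₀, α₁, …, αₙ = β` with `⟨αᵢ, αᵢ₋₁^∨⟩ ≠ 0` for `i = 1, …, n`. -/
def ConnectedRoots (R : PreReflectionSystem K X) (α β : R.roots) : Prop :=
  Relation.ReflTransGen (fun γ δ : R.roots => R.coroot γ (δ : X) ≠ 0) α β

/-- `C` is a connected component of `Re(R) = R^re ∪ {0}`: the union of `{0}` and the
connectedness class of a real root. -/
def IsConnectedComponent (R : PreReflectionSystem K X) (C : Set X) : Prop :=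
  ∃ α : R.roots, (α : X) ∈ R.realRoots ∧
    C = {0} ∪ {x | x ∈ R.realRoots ∧ ∃ h : x ∈ R.roots, R.ConnectedRoots α ⟨x, h⟩}

/-- `Re(R)` is connected: it has exactly one connected component. -/
def RealPartConnected (R : PreReflectionSystem K X) : Prop :=
  ∃! C : Set X, R.IsConnectedComponent C

/-- `e : X₁ ⊕ X₂ ≃ X` is an isomorphism of the direct sum of `(R₁, X₁)` and `(R₂, X₂)` onto
`(R, X)`. In the direct sum the roots are `R₁ ∪ R₂`, and a reflection in a root of one summand
is extended by the identity on the other summand. -/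
structure IsDirectSum {X₁ : Type v} {X₂ : Type v} [AddCommGroup X₁] [Module K X₁]
    [AddCommGroup X₂] [Module K X₂] (R : PreReflectionSystem K X)
    (R₁ : PreReflectionSystem K X₁) (R₂ : PreReflectionSystem K X₂)
    (e : (X₁ × X₂) ≃ₗ[K] X) : Prop where
  roots_eq : R.roots = (fun a : X₁ => e (a, 0)) '' R₁.roots ∪ (fun a : X₂ => e (0, a)) '' R₂.roots
  s_left : ∀ (a : R₁.roots) (h : e ((a : X₁), 0) ∈ R.roots) (x : X₁) (y : X₂),
    R.s ⟨e ((a : X₁), 0), h⟩ (e (x, y)) = e (R₁.s a x, y)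
  s_right : ∀ (a : R₂.roots) (h : e (0, (a : X₂)) ∈ R.roots) (x : X₁) (y : X₂),
    R.s ⟨e (0, (a : X₂)), h⟩ (e (x, y)) = e (x, R₂.s a y)

/-- `R` has a real root and is not isomorphic to a direct sum of two pre-reflection systems that
both have real roots. (Direct summands embed in `X`, so their universe is no restriction.) -/
def IsIndecomposable (R : PreReflectionSystem K X) : Prop :=
  R.realRoots.Nonempty ∧
    ¬ ∃ (X₁ X₂ : Type v) (_ : AddCommGroup X₁) (_ : Module K X₁) (_ : AddCommGroup X₂)
      (_ : Module K X₂) (R₁ : PreReflectionSystem K X₁) (R₂ : PreReflectionSystem K X₂)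
      (e : (X₁ × X₂) ≃ₗ[K] X),
      R.IsDirectSum R₁ R₂ e ∧ R₁.realRoots.Nonempty ∧ R₂.realRoots.Nonempty

/-- An irreducible locally finite root system is one that is indecomposable. -/
def IsIrreducible (R : PreReflectionSystem K X) : Prop :=
  R.IsLocallyFiniteRootSystem ∧ R.IsIndecomposable

/-! ### Affine forms -/

/-- An affine form: a symmetric bilinear form, invariant under the Weyl group, with
`R^im = R ∩ Rad b`. For symmetric `b` the radical of `b` is `LinearMap.ker b`. -/
def IsAffineForm (R : PreReflectionSystem K X) (b : LinearMap.BilinForm K X) : Prop :=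
  b.IsSymm ∧ (∀ g ∈ R.weylGroup, ∀ x y : X, b (g x) (g y) = b x y) ∧
    R.imRoots = R.roots ∩ (LinearMap.ker b : Set X)

/-- The set of square lengths `b(α, α)` of the nonzero elements `α` of `C`. -/
def squareLengths (b : LinearMap.BilinForm K X) (C : Set X) : Set K :=
  {t | ∃ α ∈ C, α ≠ 0 ∧ b α α = t}

/-- `b` is normalized: on each connected component of `Re(R)` the square lengths of the nonzero
roots lie in `{2, 3, 4, 6, 8}`, and `2` occurs. -/
def IsNormalized (R : PreReflectionSystem K X) (b : LinearMap.BilinForm K X) : Prop :=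
  ∀ C : Set X, R.IsConnectedComponent C →
    (2 : K) ∈ squareLengths b C ∧ squareLengths b C ⊆ {2, 3, 4, 6, 8}

end PreReflectionSystem

/-! Everything rests on one identity: invariance of a form `b` under `s_α` gives `2 b(x, α) = ⟨x,
α^∨⟩ b(α, α)`. For an affine form, `b(α, α) ≠ 0` at real roots, so `Rad b` is the common kernel of
all coroots and does not depend on `b`.

From a form to the quotient: roots congruent modulo `Rad b` have the same coroot, so reflections
descend to `X / Rad b` (`quotientSystem`). A finite-dimensional subspace of the quotient is
separated by finitely many coroots, each with finitely many values on the roots by integrality and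
boundedness; hence the quotient is locally finite (`isLocallyFinite_quotientSystem`).

From an extension `f : R → S` to a form: coroots of `R` are pullbacks of those of `S`, so it
suffices to symmetrize the pairing of `S`. On the finitely many roots in the span of a finite set,
`∑ ⟨x, γ^∨⟩⟨y, γ^∨⟩` does this; ratios of its values along a chain of nonorthogonal roots do not
change as the set grows, so they glue over each component (`exists_symmetrizer`), and a symmetrizer
defines a form (`exists_affineForm_of_symmetrizer`). Cauchy–Schwarz bounds products of opposite
pairings by 4, whence boundedness (`pairingInt_mul_bounds`, `abs_pairingInt_le`). Coroots of `S`
separate points, so `Ker f` is again the common kernel of the coroots of `R`, that is, `Rad b`.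

Irreducibility: a class of connected roots and its complement split a locally finite system as a
direct sum.

Normalization: within a component two square lengths always have ratio `k` or `1/k` with `1 ≤ k ≤ 4`
(`squareLength_ratio`). Scaling the shortest to 2 on every component yields existence, and the ratio
of two affine forms being constant on a component yields uniqueness. Semidefiniteness follows by
writing `f x` as `∑ d_γ ⟨f x, γ^∨⟩ γ` with rational `d_γ ≥ 0`. -/

namespace PreReflectionSystem

/-! ### Elementary properties of coroots and reflections -/

section Basic

variable {K : Type u} {X : Type v} [Field K] [AddCommGroup X] [Module K X]
  (R : PreReflectionSystem K X)

theorem mem_realRoots_iff (α : R.roots) : (α : X) ∈ R.realRoots ↔ R.s α ≠ 1 :=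
  ⟨fun ⟨_, h⟩ => h, fun h => ⟨α.2, h⟩⟩

theorem mem_imRoots_iff (α : R.roots) : (α : X) ∈ R.imRoots ↔ R.s α = 1 :=
  ⟨fun ⟨_, h⟩ => h, fun h => ⟨α.2, h⟩⟩

theorem realRoots_subset : R.realRoots ⊆ R.roots := fun _ h => h.1

theorem imRoots_subset : R.imRoots ⊆ R.roots := fun _ h => h.1

theorem coe_ne_zero {α : R.roots} (h : R.s α ≠ 1) : (α : X) ≠ 0 := by
  intro h0
  obtain ⟨-, h2⟩ := R.s_apply_self α h
  simp [h0] at h2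

theorem coroot_eq_zero {α : R.roots} (h : R.s α = 1) : R.coroot α = 0 := by
  simp [coroot, h]

theorem coroot_eq {α : R.roots} (h : R.s α ≠ 1) {φ : Dual K X}
    (hφ : ∀ x, R.s α x = x - φ x • (α : X)) : R.coroot α = φ := by
  ext x
  have h1 := (R.s_apply α x).symm.trans (hφ x)
  have h2 : R.coroot α x • (α : X) = φ x • (α : X) := by simpa using h1
  exact smul_left_injective K (R.coe_ne_zero h) h2

theorem s_eq_one_of_coroot {α : R.roots} (h : R.coroot α = 0) : R.s α = 1 := by
  ext x
  simp [R.s_apply, h]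

theorem coroot_ne_zero_iff {α : R.roots} : R.coroot α ≠ 0 ↔ R.s α ≠ 1 :=
  not_congr ⟨R.s_eq_one_of_coroot, R.coroot_eq_zero⟩

theorem real_of_coroot_apply_ne_zero {α : R.roots} {x : X} (h : R.coroot α x ≠ 0) :
    R.s α ≠ 1 := fun h1 => h (by simp [R.coroot_eq_zero h1])

theorem coroot_self {α : R.roots} (h : R.s α ≠ 1) : R.coroot α (α : X) = 2 := by
  have h1 := (R.s_apply_self α h).1
  rw [R.s_apply] at h1
  have h2 : (R.coroot α (α : X) - 2) • (α : X) = 0 := by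
    rw [sub_smul, two_smul, sub_eq_zero, ← sub_eq_iff_eq_add, ← neg_inj, neg_sub, h1]
  rcases smul_eq_zero.1 h2 with h3 | h3
  · exact sub_eq_zero.1 h3
  · exact absurd h3 (R.coe_ne_zero h)

theorem s_s_apply (α : R.roots) (x : X) : R.s α (R.s α x) = x :=
  LinearEquiv.congr_fun (R.s_mul_self α) x

theorem s_apply_mem_realRoots (α : R.roots) {x : X} (h : x ∈ R.realRoots) :
    R.s α x ∈ R.realRoots := by
  have := R.s_image_real α
  exact this.subset ⟨x, h, rfl⟩

theorem s_apply_mem_imRoots (α : R.roots) {x : X} (h : x ∈ R.imRoots) :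
    R.s α x ∈ R.imRoots := by
  have := R.s_image_im α
  exact this.subset ⟨x, h, rfl⟩

theorem s_apply_mem (α β : R.roots) : R.s α (β : X) ∈ R.roots := by
  by_cases h : R.s β = 1
  · exact R.imRoots_subset (R.s_apply_mem_imRoots α ((R.mem_imRoots_iff β).2 h))
  · exact R.realRoots_subset (R.s_apply_mem_realRoots α ((R.mem_realRoots_iff β).2 h))

/-- The root `s_α β`. -/
def reflect (α β : R.roots) : R.roots := ⟨R.s α β, R.s_apply_mem α β⟩

@[simp] theorem coe_reflect (α β : R.roots) : (R.reflect α β : X) = R.s α β := rfl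

theorem reflect_reflect (α β : R.roots) : R.reflect α (R.reflect α β) = β :=
  Subtype.ext (R.s_s_apply α β)

theorem s_reflect_ne_one (α : R.roots) {β : R.roots} (h : R.s β ≠ 1) :
    R.s (R.reflect α β) ≠ 1 :=
  (R.mem_realRoots_iff _).1 (R.s_apply_mem_realRoots α ((R.mem_realRoots_iff β).2 h))

theorem s_reflect_eq_one (α : R.roots) {β : R.roots} (h : R.s β = 1) :
    R.s (R.reflect α β) = 1 :=
  (R.mem_imRoots_iff _).1 (R.s_apply_mem_imRoots α ((R.mem_imRoots_iff β).2 h))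

theorem s_zero (h0 : (0 : X) ∈ R.roots) : R.s ⟨0, h0⟩ = 1 := by
  by_contra h1
  exact R.coe_ne_zero h1 rfl

theorem linearMap_ext {Y : Type*} [AddCommGroup Y] [Module K Y] {f g : X →ₗ[K] Y}
    (h : ∀ α : R.roots, f (α : X) = g (α : X)) : f = g :=
  LinearMap.ext_on R.span_roots fun x hx => h ⟨x, hx⟩

end Basic

/-! ### Building a pre-reflection system from prescribed coroots -/

section OfCoroots

variable {K : Type u} {X : Type v} [Field K] [AddCommGroup X] [Module K X]

/-- The involution `x ↦ x - φ(x) α`, where `φ = 0` or `φ(α) = 2`. -/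
def corootReflection {α : X} {φ : Dual K X} (h : φ ≠ 0 → φ α = 2) : X ≃ₗ[K] X :=
  LinearEquiv.ofInvolutive (preReflection α φ) (by
    by_cases h0 : φ = 0
    · intro x
      simp [preReflection_apply, h0]
    · exact involutive_preReflection (h h0))

theorem corootReflection_apply {α : X} {φ : Dual K X} (h : φ ≠ 0 → φ α = 2) (x : X) :
    corootReflection h x = x - φ x • α := preReflection_apply _ _ _

variable [CharZero K]

theorem corootReflection_eq_one_iff {α : X} {φ : Dual K X} (h : φ ≠ 0 → φ α = 2) :
    corootReflection h = 1 ↔ φ = 0 := by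
  constructor
  · intro h1
    by_contra h0
    have h2 := LinearEquiv.congr_fun h1 α
    rw [corootReflection_apply, h h0] at h2
    have h3 : α = 0 := by simpa using h2
    have h4 := h h0
    simp [h3] at h4
  · intro h0
    ext x
    simp [corootReflection_apply, h0]

/-- A pre-reflection system constructed from a set of roots and the coroots. -/
def ofCoroots (Φ : Set X) (φ : Φ → Dual K X) (h0 : (0 : X) ∈ Φ)
    (hspan : Submodule.span K Φ = ⊤) (h2 : ∀ α, φ α ≠ 0 → φ α (α : X) = 2)
    (hre : ∀ α β : Φ, φ β ≠ 0 → ∃ h : (β : X) - φ α β • (α : X) ∈ Φ, φ ⟨_, h⟩ ≠ 0)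
    (him : ∀ α β : Φ, φ β = 0 → ∃ h : (β : X) - φ α β • (α : X) ∈ Φ, φ ⟨_, h⟩ = 0) :
    PreReflectionSystem K X where
  roots := Φ
  s α := corootReflection (h2 α)
  zero_mem := h0
  span_roots := hspan
  codim_fixed_le_one α := by
    rw [(LinearMap.quotKerEquivRange _).rank_eq]
    refine (Submodule.rank_mono (t := Submodule.span K {(α : X)}) ?_).trans
      ((rank_span_le _).trans (by simp))
    rintro _ ⟨x, rfl⟩
    rw [Submodule.mem_span_singleton]
    exact ⟨-φ α x, by simp [corootReflection_apply]⟩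
  s_mul_self α := by
    ext x
    by_cases h : φ α = 0
    · simp [corootReflection_apply, h]
    · simp [corootReflection_apply, h2 α h, mul_two]
  s_apply_self α h := by
    rw [ne_eq, corootReflection_eq_one_iff] at h
    have h3 : (α : X) ≠ 0 := fun h3 => by
      have := h2 α h
      simp [h3] at this
    refine ⟨by rw [corootReflection_apply, h2 α h, two_smul]; abel, fun h4 => h3 ?_⟩
    have h5 : (2 : K) • (α : X) = 0 := by
      rw [two_smul]; nth_rw 1 [← h4]; simp
    simpa using h5
  s_image_real α := by
    have key : ∀ x ∈ realRootsOf Φ (fun α => corootReflection (h2 α)),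
        corootReflection (h2 α) x ∈ realRootsOf Φ (fun α => corootReflection (h2 α)) := by
      rintro x ⟨hx, h⟩
      rw [ne_eq, corootReflection_eq_one_iff] at h
      obtain ⟨h5, h6⟩ := hre α ⟨x, hx⟩ h
      rw [corootReflection_apply]
      exact ⟨h5, by rwa [ne_eq, corootReflection_eq_one_iff]⟩
    refine Set.Subset.antisymm (Set.image_subset_iff.2 key) fun x hx => ⟨_, key x hx, ?_⟩
    exact LinearEquiv.apply_symm_apply (corootReflection (h2 α)) x
  s_image_im α := by
    have key : ∀ x ∈ imRootsOf Φ (fun α => corootReflection (h2 α)),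
        corootReflection (h2 α) x ∈ imRootsOf Φ (fun α => corootReflection (h2 α)) := by
      rintro x ⟨hx, h⟩
      rw [corootReflection_eq_one_iff] at h
      obtain ⟨h5, h6⟩ := him α ⟨x, hx⟩ h
      rw [corootReflection_apply]
      exact ⟨h5, by rwa [corootReflection_eq_one_iff]⟩
    refine Set.Subset.antisymm (Set.image_subset_iff.2 key) fun x hx => ⟨_, key x hx, ?_⟩
    exact LinearEquiv.apply_symm_apply (corootReflection (h2 α)) x

end OfCoroots

/-! ### Affine forms and symmetrizers of the Cartan pairing -/

section AffineForm

variable {K : Type u} {X : Type v} [Field K] [AddCommGroup X] [Module K X]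
  {R : PreReflectionSystem K X} {b : LinearMap.BilinForm K X}

theorem s_mem_weylGroup (R : PreReflectionSystem K X) (α : R.roots) : R.s α ∈ R.weylGroup :=
  Subgroup.subset_closure ⟨α, rfl⟩

theorem mem_ker_iff_forall_roots {x : X} :
    x ∈ LinearMap.ker b ↔ ∀ α : R.roots, b x α = 0 := by
  rw [LinearMap.mem_ker]
  exact ⟨fun h α => by simp [h], fun h => R.linearMap_ext (by simpa using h)⟩

/-- Expand `b(s_α x, -α) = b(x, α)`. Only this one instance of invariance is assumed, so that the
identity also serves the local forms below, which are invariant under some reflections only. -/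
theorem two_mul_form_of_invariant {α : R.roots} {x : X}
    (hb : b (R.s α x) (R.s α (α : X)) = b x α) (h : R.s α ≠ 1) :
    2 * b x α = R.coroot α x * b α α := by
  rw [(R.s_apply_self α h).1, R.s_apply] at hb
  simp only [map_sub, map_smul, map_neg, LinearMap.sub_apply, LinearMap.smul_apply,
    smul_eq_mul] at hb
  linear_combination -hb

namespace IsAffineForm

theorem apply_comm (hb : R.IsAffineForm b) (x y : X) : b x y = b y x := hb.1.eq x y

theorem mem_ker_of_eq_one (hb : R.IsAffineForm b) {α : R.roots} (h : R.s α = 1) :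
    (α : X) ∈ LinearMap.ker b := by
  have h1 : (α : X) ∈ R.imRoots := (R.mem_imRoots_iff α).2 h
  rw [hb.2.2] at h1
  exact h1.2

theorem apply_s_apply_s (hb : R.IsAffineForm b) (α : R.roots) (x y : X) :
    b (R.s α x) (R.s α y) = b x y := hb.2.1 _ (R.s_mem_weylGroup α) x y

theorem two_mul_apply (hb : R.IsAffineForm b) (α : R.roots) (x : X) :
    2 * b x α = R.coroot α x * b α α := by
  by_cases h : R.s α = 1
  · have h1 := LinearMap.mem_ker.1 (hb.mem_ker_of_eq_one h)
    rw [hb.apply_comm, h1]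
    simp
  · exact two_mul_form_of_invariant (hb.2.1 _ (R.s_mem_weylGroup α) _ _) h

theorem symmetrizes (hb : R.IsAffineForm b) (α β : R.roots) :
    b β β * R.coroot β α = b α α * R.coroot α β := by
  linear_combination hb.two_mul_apply α (β : X) - hb.two_mul_apply β (α : X)
    + 2 * hb.apply_comm (α : X) (β : X)

variable [CharZero K]

/-- If `b(α, α) = 0`, then `α` is orthogonal to all roots by `two_mul_apply`, hence lies in the
radical and is imaginary. -/
theorem apply_self_ne_zero (hb : R.IsAffineForm b) {α : R.roots} (h : R.s α ≠ 1) :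
    b α α ≠ 0 := by
  intro h0
  apply h
  rw [← R.mem_imRoots_iff, hb.2.2]
  refine ⟨α.2, (mem_ker_iff_forall_roots (R := R)).2 fun β => ?_⟩
  rw [hb.apply_comm]
  have := hb.two_mul_apply α (β : X)
  simpa [h0] using this

/-- The right side does not mention `b`: all affine forms share one radical. -/
theorem mem_ker_iff_coroot (hb : R.IsAffineForm b) {x : X} :
    x ∈ LinearMap.ker b ↔ ∀ α : R.roots, R.coroot α x = 0 := by
  rw [mem_ker_iff_forall_roots (R := R)]
  refine forall_congr' fun α => ?_
  have h1 := hb.two_mul_apply α x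
  by_cases h : R.s α = 1
  · rw [R.coroot_eq_zero h] at h1 ⊢
    simpa using h1
  · constructor
    · intro h2
      rw [h2, mul_zero] at h1
      exact (mul_eq_zero.1 h1.symm).resolve_right (hb.apply_self_ne_zero h)
    · intro h2
      simpa [h2] using h1

theorem coroot_apply_eq_zero_comm (hb : R.IsAffineForm b) {α β : R.roots}
    (h : R.coroot α (β : X) = 0) : R.coroot β (α : X) = 0 := by
  by_cases h1 : R.s β = 1
  · simp [R.coroot_eq_zero h1]
  · have := hb.symmetrizes α β
    rw [h, mul_zero] at this
    exact (mul_eq_zero.1 this).resolve_left (hb.apply_self_ne_zero h1)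

end IsAffineForm

variable [CharZero K]

/-- A function symmetrizing the pairing of roots and coroots defines an affine form. -/
theorem exists_affineForm_of_symmetrizer (R : PreReflectionSystem K X) (q : R.roots → K)
    (hq : ∀ α β : R.roots, q β * R.coroot β α = q α * R.coroot α β)
    (hq0 : ∀ α, R.s α ≠ 1 → q α ≠ 0) :
    ∃ b : LinearMap.BilinForm K X, R.IsAffineForm b ∧
      ∀ (α : R.roots) (x : X), b x α = q α / 2 * R.coroot α x := by
  -- `D` is the wanted form on formal combinations of roots. Symmetry of the pairing scaled by `q`
  -- shows that `D c` depends only on the vector `p c`, so `D` descends along the surjection `p`;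
  -- the section `g` merely realizes this descent.
  let D : (R.roots →₀ K) →ₗ[K] Dual K X :=
    Finsupp.linearCombination K fun α => (q α / 2) • R.coroot α
  let p : (R.roots →₀ K) →ₗ[K] X := Finsupp.linearCombination K fun α => (α : X)
  have hp : LinearMap.range p = ⊤ := by
    rw [Finsupp.range_linearCombination, Subtype.range_coe, R.span_roots]
  have hD : ∀ (c : R.roots →₀ K) (γ : R.roots), D c γ = q γ / 2 * R.coroot γ (p c) := by
    intro c γ
    have : (LinearMap.applyₗ (γ : X)) ∘ₗ D = ((q γ / 2) • R.coroot γ) ∘ₗ p := by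
      ext α
      simp only [D, p, LinearMap.comp_apply, Finsupp.lsingle_apply,
        Finsupp.linearCombination_single, LinearMap.applyₗ_apply_apply, LinearMap.smul_apply,
        smul_eq_mul, one_smul]
      linear_combination hq γ α / 2
    exact LinearMap.congr_fun this c
  have hker : LinearMap.ker p ≤ LinearMap.ker D := by
    intro c hc
    rw [LinearMap.mem_ker] at hc ⊢
    refine R.linearMap_ext fun γ => ?_
    rw [hD, hc]
    simp
  obtain ⟨g, hg⟩ := LinearMap.exists_rightInverse_of_surjective p hp
  let b : LinearMap.BilinForm K X := D ∘ₗ g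
  have hbp : ∀ c, b (p c) = D c := by
    intro c
    have : g (p c) - c ∈ LinearMap.ker p := by
      rw [LinearMap.mem_ker, map_sub, ← LinearMap.comp_apply, hg]
      simp
    have h2 := hker this
    rw [LinearMap.mem_ker, map_sub, sub_eq_zero] at h2
    exact h2
  have hb : ∀ (α : R.roots) (x : X), b x α = q α / 2 * R.coroot α x := by
    intro α x
    obtain ⟨c, rfl⟩ : x ∈ LinearMap.range p := hp ▸ Submodule.mem_top
    rw [hbp, hD]
  have hb' : ∀ (α : R.roots) (x : X), b α x = q α / 2 * R.coroot α x := by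
    intro α x
    have h1 : p (Finsupp.single α 1) = (α : X) := by simp [p]
    rw [← h1, hbp]
    simp [D]
  have hflip : b.flip = b := by
    refine R.linearMap_ext fun α => LinearMap.ext fun x => ?_
    exact (hb α x).trans (hb' α x).symm
  have hsymm : ∀ x y, b x y = b y x := fun x y => LinearMap.congr_fun₂ hflip y x
  have hinv : ∀ (α : R.roots) (x y : X), b (R.s α x) (R.s α y) = b x y := by
    intro α x y
    have h1 := hb α α
    have h2 : R.coroot α α • R.coroot α = (2 : K) • R.coroot α := by
      by_cases h : R.s α = 1
      · simp [R.coroot_eq_zero h]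
      · rw [R.coroot_self h]
    have h3 := LinearMap.congr_fun h2 x
    simp only [LinearMap.smul_apply, smul_eq_mul] at h3
    simp only [R.s_apply, map_sub, map_smul, LinearMap.sub_apply, LinearMap.smul_apply,
      smul_eq_mul, hb, hb']
    linear_combination q α / 2 * R.coroot α y * h3
  refine ⟨b, ⟨⟨fun x y => hsymm x y⟩, ?_, ?_⟩, hb⟩
  · intro g hg
    induction hg using Subgroup.closure_induction with
    | mem g h =>
      obtain ⟨α, rfl⟩ := h
      exact hinv α
    | one => simp
    | mul g h _ _ hg hh =>
      intro x y
      rw [LinearEquiv.mul_apply, LinearEquiv.mul_apply, hg, hh]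
    | inv g _ hg =>
      intro x y
      rw [← hg]
      congr 1
      · congr 1
        exact LinearEquiv.apply_symm_apply g x
      · exact LinearEquiv.apply_symm_apply g y
  · ext x
    constructor
    · rintro ⟨h, h1⟩
      refine ⟨h, ?_⟩
      rw [SetLike.mem_coe, LinearMap.mem_ker]
      ext y
      rw [hb' ⟨x, h⟩ y, R.coroot_eq_zero h1]
      simp
    · rintro ⟨h, h1⟩
      refine ⟨h, ?_⟩
      by_contra h2
      have h3 := hb' ⟨x, h⟩ x
      rw [LinearMap.mem_ker.1 h1, R.coroot_self (α := ⟨x, h⟩) h2] at h3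
      exact hq0 ⟨x, h⟩ h2 (by simpa using h3.symm)

end AffineForm

/-! ### Locally finite root systems: local forms, bounds on pairings, symmetrizability -/

section LocallyFinite

variable {K : Type u} {X : Type v} [Field K] [AddCommGroup X] [Module K X]
  {S : PreReflectionSystem K X}

/-- The span of a finite set of roots. -/
def rootSpan (S : PreReflectionSystem K X) (A : Finset S.roots) : Submodule K X :=
  Submodule.span K (Subtype.val '' (A : Set S.roots))

theorem mem_rootSpan {A : Finset S.roots} {α : S.roots} (h : α ∈ A) :
    (α : X) ∈ S.rootSpan A := Submodule.subset_span ⟨α, h, rfl⟩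

instance (A : Finset S.roots) : FiniteDimensional K (S.rootSpan A) :=
  FiniteDimensional.span_of_finite K (A.finite_toSet.image _)

theorem exists_mem_rootSpan (S : PreReflectionSystem K X) (x : X) :
    ∃ A : Finset S.roots, x ∈ S.rootSpan A := by
  classical
  obtain ⟨T, hT, hx⟩ := Submodule.mem_span_finite_of_mem_span
    (show x ∈ Submodule.span K S.roots from S.span_roots ▸ Submodule.mem_top)
  refine ⟨T.subtype (· ∈ S.roots), Submodule.span_mono ?_ hx⟩
  intro y hy
  exact ⟨⟨y, hT hy⟩, by simpa using hy, rfl⟩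

namespace IsLocallyFiniteRootSystem

theorem finite_roots_rootSpan (hS : S.IsLocallyFiniteRootSystem) (A : Finset S.roots) :
    (S.roots ∩ (S.rootSpan A : Set X)).Finite := hS.2.2 _ inferInstance

/-- The roots in the span of the finite set `A` of roots. -/
noncomputable def rootsIn (hS : S.IsLocallyFiniteRootSystem) (A : Finset S.roots) :
    Finset S.roots :=
  (show {γ : S.roots | (γ : X) ∈ S.rootSpan A}.Finite from
    Set.Finite.of_finite_image ((hS.finite_roots_rootSpan A).subset (by
      rintro _ ⟨γ, h, rfl⟩
      exact ⟨γ.2, h⟩)) Subtype.val_injective.injOn).toFinset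

theorem mem_rootsIn (hS : S.IsLocallyFiniteRootSystem) {A : Finset S.roots} {γ : S.roots} :
    γ ∈ hS.rootsIn A ↔ (γ : X) ∈ S.rootSpan A := by
  simp [rootsIn]

theorem s_apply_mem_rootSpan {A : Finset S.roots} {β : S.roots}
    (hβ : (β : X) ∈ S.rootSpan A) {x : X} (hx : x ∈ S.rootSpan A) : S.s β x ∈ S.rootSpan A := by
  rw [S.s_apply]
  exact Submodule.sub_mem _ hx (Submodule.smul_mem _ _ hβ)

theorem reflect_mem_rootsIn (hS : S.IsLocallyFiniteRootSystem) {A : Finset S.roots}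
    {β γ : S.roots} (hβ : β ∈ hS.rootsIn A) (hγ : γ ∈ hS.rootsIn A) :
    S.reflect β γ ∈ hS.rootsIn A :=
  hS.mem_rootsIn.2 (s_apply_mem_rootSpan (hS.mem_rootsIn.1 hβ) (hS.mem_rootsIn.1 hγ))

theorem sum_reflect (hS : S.IsLocallyFiniteRootSystem) {A : Finset S.roots} {β : S.roots}
    (hβ : β ∈ hS.rootsIn A) {M : Type*} [AddCommMonoid M] (f : S.roots → M) :
    ∑ γ ∈ hS.rootsIn A, f (S.reflect β γ) = ∑ γ ∈ hS.rootsIn A, f γ :=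
  Finset.sum_nbij' (S.reflect β) (S.reflect β) (fun _ h => hS.reflect_mem_rootsIn hβ h)
    (fun _ h => hS.reflect_mem_rootsIn hβ h) (fun _ _ => S.reflect_reflect _ _)
    (fun _ _ => S.reflect_reflect _ _) (fun _ _ => rfl)

/-- The bilinear form `∑ ⟨x, γ^∨⟩ ⟨y, γ^∨⟩`, the sum extending over the roots in the span
of `A`. -/
noncomputable def localForm (hS : S.IsLocallyFiniteRootSystem) (A : Finset S.roots) :
    LinearMap.BilinForm K X :=
  ∑ γ ∈ hS.rootsIn A, LinearMap.BilinForm.linMulLin (S.coroot γ) (S.coroot γ)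

theorem localForm_apply (hS : S.IsLocallyFiniteRootSystem) (A : Finset S.roots) (x y : X) :
    hS.localForm A x y = ∑ γ ∈ hS.rootsIn A, S.coroot γ x * S.coroot γ y := by
  simp [localForm, LinearMap.sum_apply]

theorem localForm_comm (hS : S.IsLocallyFiniteRootSystem) (A : Finset S.roots) (x y : X) :
    hS.localForm A x y = hS.localForm A y x := by
  simp only [localForm_apply, mul_comm]

/-- The operator `x ↦ ∑ ⟨x, γ^∨⟩ γ`, the sum extending over the roots in the span of `A`. -/
noncomputable def localOp (hS : S.IsLocallyFiniteRootSystem) (A : Finset S.roots) : X →ₗ[K] X :=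
  ∑ γ ∈ hS.rootsIn A, (S.coroot γ).smulRight (γ : X)

theorem localOp_apply (hS : S.IsLocallyFiniteRootSystem) (A : Finset S.roots) (x : X) :
    hS.localOp A x = ∑ γ ∈ hS.rootsIn A, S.coroot γ x • (γ : X) := by
  simp [localOp, LinearMap.sum_apply]

/-- The integer `⟨β, α^∨⟩`. -/
noncomputable def pairingInt (hS : S.IsLocallyFiniteRootSystem) (α β : S.roots) : ℤ :=
  (hS.1 α β).choose

theorem coroot_apply (hS : S.IsLocallyFiniteRootSystem) (α β : S.roots) :
    S.coroot α (β : X) = (hS.pairingInt α β : K) := (hS.1 α β).choose_spec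

theorem localForm_eq_intCast (hS : S.IsLocallyFiniteRootSystem) (A : Finset S.roots)
    (α β : S.roots) : hS.localForm A α β =
      ((∑ γ ∈ hS.rootsIn A, hS.pairingInt γ α * hS.pairingInt γ β : ℤ) : K) := by
  simp [localForm_apply, hS.coroot_apply]

theorem real_iff_ne_zero (hS : S.IsLocallyFiniteRootSystem) {β : S.roots} :
    S.s β ≠ 1 ↔ (β : X) ≠ 0 := by
  refine ⟨S.coe_ne_zero, fun h => ?_⟩
  rcases hS.2.1.subset β.2 with h1 | h1
  · exact (S.mem_realRoots_iff β).1 h1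
  · exact absurd h1 h

variable [CharZero K]

/-- The axioms do not include `s_{s_β γ} = s_β s_γ s_β`. Here it follows from local finiteness: both
sides are reflections in the vector `s_β γ` that preserve a finite set of roots spanning a subspace
that contains `x`, and such a reflection is unique. -/
theorem coroot_reflect (hS : S.IsLocallyFiniteRootSystem) (β γ : S.roots) (x : X) :
    S.coroot (S.reflect β γ) x = S.coroot γ (S.s β x) := by
  classical
  by_cases h : S.s γ = 1
  · rw [S.coroot_eq_zero h, S.coroot_eq_zero (S.s_reflect_eq_one β h)]
    simp
  have h' := S.s_reflect_ne_one β h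
  obtain ⟨A, hA⟩ := S.exists_mem_rootSpan x
  let B := insert β (insert γ A)
  have hβ : (β : X) ∈ S.rootSpan B := mem_rootSpan (by simp [B])
  have hγ : (γ : X) ∈ S.rootSpan B := mem_rootSpan (by simp [B])
  have hx : x ∈ Submodule.span K (S.roots ∩ (S.rootSpan B : Set X)) := by
    refine Submodule.span_mono ?_ hA
    rintro _ ⟨α, hα, rfl⟩
    exact ⟨α.2, mem_rootSpan (by simp only [B, Finset.mem_insert]; exact Or.inr (Or.inr hα))⟩
  have hm : ((S.reflect β γ : S.roots) : X) ∈ S.roots ∩ (S.rootSpan B : Set X) :=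
    ⟨(S.reflect β γ).2, s_apply_mem_rootSpan hβ hγ⟩
  have key := Dual.eq_of_preReflection_mapsTo' (hS.finite_roots_rootSpan B)
    (Submodule.subset_span hm) (f := S.coroot (S.reflect β γ))
    (g := (S.coroot γ) ∘ₗ (S.s β : X →ₗ[K] X)) (S.coroot_self h') ?_ ?_ ?_
  · exact LinearMap.congr_fun key ⟨x, hx⟩
  · rintro y ⟨hy, hy'⟩
    rw [preReflection_apply, ← S.s_apply]
    exact ⟨S.s_apply_mem _ ⟨y, hy⟩, s_apply_mem_rootSpan hm.2 hy'⟩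
  · simp [S.s_s_apply, S.coroot_self h]
  · rintro y ⟨hy, hy'⟩
    have h1 : preReflection ((S.reflect β γ : S.roots) : X)
        ((S.coroot γ) ∘ₗ (S.s β : X →ₗ[K] X)) y = S.s β (S.s γ (S.s β y)) := by
      rw [preReflection_apply, S.s_apply γ, map_sub, S.s_s_apply, map_smul]
      rfl
    rw [h1]
    exact ⟨(S.reflect β (S.reflect γ (S.reflect β ⟨y, hy⟩))).2,
      s_apply_mem_rootSpan hβ (s_apply_mem_rootSpan hγ (s_apply_mem_rootSpan hβ hy'))⟩

/-- A reflection in a root of the span permutes the roots over which the sum extends, and carries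
coroots along. -/
theorem localForm_s_s (hS : S.IsLocallyFiniteRootSystem) {A : Finset S.roots} {β : S.roots}
    (hβ : β ∈ hS.rootsIn A) (x y : X) :
    hS.localForm A (S.s β x) (S.s β y) = hS.localForm A x y := by
  simp only [localForm_apply, ← hS.coroot_reflect]
  exact hS.sum_reflect hβ fun γ => S.coroot γ x * S.coroot γ y

theorem two_mul_localForm (hS : S.IsLocallyFiniteRootSystem) {A : Finset S.roots} {β : S.roots}
    (hβ : β ∈ hS.rootsIn A) (h : S.s β ≠ 1) (x : X) :
    2 * hS.localForm A x β = S.coroot β x * hS.localForm A β β :=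
  two_mul_form_of_invariant (hS.localForm_s_s hβ _ _) h

theorem pairingInt_self (hS : S.IsLocallyFiniteRootSystem) {β : S.roots} (h : S.s β ≠ 1) :
    hS.pairingInt β β = 2 := by
  have := hS.coroot_apply β β
  rw [S.coroot_self h] at this
  exact_mod_cast this.symm

theorem pairingInt_of_eq_one (hS : S.IsLocallyFiniteRootSystem) {β : S.roots} (h : S.s β = 1)
    (γ : S.roots) : hS.pairingInt β γ = 0 := by
  have := hS.coroot_apply β γ
  rw [S.coroot_eq_zero h, LinearMap.zero_apply] at this
  exact_mod_cast this.symm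

theorem pairingInt_apply_eq_one (hS : S.IsLocallyFiniteRootSystem) {β : S.roots}
    (h : S.s β = 1) (γ : S.roots) : hS.pairingInt γ β = 0 := by
  have h0 : (β : X) = 0 := by
    by_contra h0
    exact hS.real_iff_ne_zero.2 h0 h
  have := hS.coroot_apply γ β
  rw [h0, map_zero] at this
  exact_mod_cast this.symm

/-- The field carries no order, so positivity is argued in `ℤ`; the term at `β` equals 4. -/
theorem sum_pairingInt_sq_pos (hS : S.IsLocallyFiniteRootSystem) {A : Finset S.roots}
    {β : S.roots} (hβ : β ∈ hS.rootsIn A) (h : S.s β ≠ 1) :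
    0 < ∑ γ ∈ hS.rootsIn A, hS.pairingInt γ β * hS.pairingInt γ β :=
  Finset.sum_pos' (fun _ _ => mul_self_nonneg _) ⟨β, hβ, by simp [hS.pairingInt_self h]⟩

theorem localForm_self_ne_zero (hS : S.IsLocallyFiniteRootSystem) {A : Finset S.roots}
    {β : S.roots} (hβ : β ∈ hS.rootsIn A) (h : S.s β ≠ 1) : hS.localForm A β β ≠ 0 := by
  rw [localForm_eq_intCast]
  exact_mod_cast (hS.sum_pairingInt_sq_pos hβ h).ne'

theorem localForm_symmetrizes (hS : S.IsLocallyFiniteRootSystem) {A : Finset S.roots}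
    {α β : S.roots} (hα : α ∈ hS.rootsIn A) (hβ : β ∈ hS.rootsIn A) :
    S.coroot β α * hS.localForm A β β = S.coroot α β * hS.localForm A α α := by
  by_cases h : S.s α = 1
  · simp [hS.coroot_apply, hS.pairingInt_of_eq_one h, hS.pairingInt_apply_eq_one h]
  by_cases h' : S.s β = 1
  · simp [hS.coroot_apply, hS.pairingInt_of_eq_one h', hS.pairingInt_apply_eq_one h']
  rw [← hS.two_mul_localForm hα h, ← hS.two_mul_localForm hβ h', hS.localForm_comm]

/-- With `P`, `Q`, `C` the local form at `(α, α)`, `(β, β)`, `(α, β)`, the product `m n` of the two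
pairings satisfies `m n P Q = 4 C²`, and Cauchy–Schwarz over `ℤ` gives `C² ≤ P Q`. -/
theorem pairingInt_mul_bounds (hS : S.IsLocallyFiniteRootSystem) (α β : S.roots) :
    0 ≤ hS.pairingInt α β * hS.pairingInt β α ∧ hS.pairingInt α β * hS.pairingInt β α ≤ 4 := by
  classical
  by_cases h : S.s α = 1
  · simp [hS.pairingInt_of_eq_one h]
  by_cases h' : S.s β = 1
  · simp [hS.pairingInt_of_eq_one h']
  let A : Finset S.roots := {α, β}
  have hα : α ∈ hS.rootsIn A := hS.mem_rootsIn.2 (mem_rootSpan (by simp [A]))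
  have hβ : β ∈ hS.rootsIn A := hS.mem_rootsIn.2 (mem_rootSpan (by simp [A]))
  have hP := hS.sum_pairingInt_sq_pos hα h
  have hQ := hS.sum_pairingInt_sq_pos hβ h'
  have h1 := hS.two_mul_localForm hα h β
  have h2 := hS.two_mul_localForm hβ h' α
  rw [hS.localForm_comm, hS.coroot_apply] at h1
  rw [hS.coroot_apply] at h2
  simp only [localForm_eq_intCast] at h1 h2
  have hCS := Finset.sum_mul_sq_le_sq_mul_sq (hS.rootsIn A) (fun γ => hS.pairingInt γ α)
    (fun γ => hS.pairingInt γ β)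
  simp only [sq (hS.pairingInt _ _)] at hCS
  generalize (∑ γ ∈ hS.rootsIn A, hS.pairingInt γ α * hS.pairingInt γ α) = P at *
  generalize (∑ γ ∈ hS.rootsIn A, hS.pairingInt γ β * hS.pairingInt γ β) = Q at *
  generalize (∑ γ ∈ hS.rootsIn A, hS.pairingInt γ α * hS.pairingInt γ β) = C at *
  generalize hS.pairingInt α β = m at *
  generalize hS.pairingInt β α = n at *
  have h1' : 2 * C = m * P := by exact_mod_cast h1
  have h2' : 2 * C = n * Q := by exact_mod_cast h2
  have h3 : (m * n) * (P * Q) = 4 * C ^ 2 := by linear_combination (-2 * C) * h1' - m * P * h2'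
  have hPQ : 0 < P * Q := mul_pos hP hQ
  constructor
  · by_contra! hneg
    nlinarith [mul_neg_of_neg_of_pos hneg hPQ, sq_nonneg C]
  · refine le_of_mul_le_mul_right ?_ hPQ
    rw [h3]
    linarith

theorem pairingInt_eq_zero_comm (hS : S.IsLocallyFiniteRootSystem) {α β : S.roots}
    (h : hS.pairingInt α β = 0) : hS.pairingInt β α = 0 := by
  classical
  by_cases h' : S.s β = 1
  · exact hS.pairingInt_of_eq_one h' α
  let A : Finset S.roots := {α, β}
  have hα : α ∈ hS.rootsIn A := hS.mem_rootsIn.2 (mem_rootSpan (by simp [A]))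
  have hβ : β ∈ hS.rootsIn A := hS.mem_rootsIn.2 (mem_rootSpan (by simp [A]))
  have h1 := hS.localForm_symmetrizes hα hβ
  rw [hS.coroot_apply α, h, Int.cast_zero, zero_mul, hS.coroot_apply] at h1
  exact_mod_cast (mul_eq_zero.1 h1).resolve_right (hS.localForm_self_ne_zero hβ h')

/-- If one pairing is nonzero, so is the opposite one, and a nonzero integer has absolute value at
least 1. -/
theorem abs_pairingInt_le (hS : S.IsLocallyFiniteRootSystem) (α β : S.roots) :
    |hS.pairingInt α β| ≤ 4 := by
  by_cases h : hS.pairingInt α β = 0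
  · simp [h]
  have h1 : hS.pairingInt β α ≠ 0 := fun h1 => h (hS.pairingInt_eq_zero_comm h1)
  have h2 := hS.pairingInt_mul_bounds α β
  have h3 := Int.one_le_abs h1
  have h4 : |hS.pairingInt α β| * |hS.pairingInt β α| ≤ 4 := by
    rw [← abs_mul, abs_of_nonneg h2.1]
    exact h2.2
  nlinarith [abs_nonneg (hS.pairingInt α β)]

theorem localOp_s (hS : S.IsLocallyFiniteRootSystem) {A : Finset S.roots} {β : S.roots}
    (hβ : β ∈ hS.rootsIn A) (x : X) : hS.localOp A (S.s β x) = S.s β (hS.localOp A x) := by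
  rw [localOp_apply, localOp_apply, map_sum, ← hS.sum_reflect hβ]
  simp [hS.coroot_reflect, S.s_s_apply]

/-- `2 ∑ ⟨α, γ^∨⟩ γ = ℓ_α α` for this integer `ℓ_α`, the sum extending over the roots in the
span of `A`. -/
noncomputable def localEigenvalue (hS : S.IsLocallyFiniteRootSystem) (A : Finset S.roots)
    (α : S.roots) : ℤ :=
  ∑ γ ∈ hS.rootsIn A, hS.pairingInt γ α * hS.pairingInt α γ

theorem localEigenvalue_nonneg (hS : S.IsLocallyFiniteRootSystem) (A : Finset S.roots)
    (α : S.roots) : 0 ≤ hS.localEigenvalue A α :=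
  Finset.sum_nonneg fun γ _ => (hS.pairingInt_mul_bounds γ α).1

theorem localEigenvalue_pos (hS : S.IsLocallyFiniteRootSystem) {A : Finset S.roots}
    {α : S.roots} (hα : α ∈ hS.rootsIn A) (h : S.s α ≠ 1) : 0 < hS.localEigenvalue A α :=
  Finset.sum_pos' (fun γ _ => (hS.pairingInt_mul_bounds γ α).1)
    ⟨α, hα, by simp [hS.pairingInt_self h]⟩

/-- The operator commutes with `s_α`, hence preserves its `-1` eigenspace, which is the line through
`α`. -/
theorem two_smul_localOp (hS : S.IsLocallyFiniteRootSystem) {A : Finset S.roots}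
    {α : S.roots} (hα : α ∈ hS.rootsIn A) (h : S.s α ≠ 1) :
    (2 : K) • hS.localOp A α = (hS.localEigenvalue A α : K) • (α : X) := by
  have h1 := hS.localOp_s hα (α : X)
  rw [(S.s_apply_self α h).1, map_neg, S.s_apply] at h1
  have h2 : S.coroot α (hS.localOp A α) = (hS.localEigenvalue A α : K) := by
    simp [localOp_apply, localEigenvalue, hS.coroot_apply]
  rw [h2] at h1
  rw [two_smul]
  nth_rw 1 [← neg_neg (hS.localOp A α), h1]
  abel

/-- The local operator is self-adjoint for the local form, so eigenvectors that are not orthogonal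
have equal eigenvalues. -/
theorem localEigenvalue_eq (hS : S.IsLocallyFiniteRootSystem) {A : Finset S.roots}
    {α β : S.roots} (hα : α ∈ hS.rootsIn A) (hβ : β ∈ hS.rootsIn A)
    (h : S.coroot β α ≠ 0) : hS.localEigenvalue A α = hS.localEigenvalue A β := by
  have h1 : S.s β ≠ 1 := S.real_of_coroot_apply_ne_zero h
  have h2 : S.s α ≠ 1 := fun h2 => h (by
    rw [hS.coroot_apply, hS.pairingInt_apply_eq_one h2, Int.cast_zero])
  have key : ∀ x y, 2 * hS.localForm A (hS.localOp A x) y =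
      ∑ δ ∈ hS.rootsIn A, S.coroot δ x * S.coroot δ y * hS.localForm A δ δ := by
    intro x y
    rw [localOp_apply, map_sum, LinearMap.sum_apply, Finset.mul_sum]
    refine Finset.sum_congr rfl fun δ hδ => ?_
    by_cases h3 : S.s δ = 1
    · simp [S.coroot_eq_zero h3]
    · have := hS.two_mul_localForm hδ h3 y
      rw [hS.localForm_comm] at this
      simp only [map_smul, LinearMap.smul_apply, smul_eq_mul]
      linear_combination S.coroot δ x * this
  have hsymm : hS.localForm A (hS.localOp A α) β = hS.localForm A (hS.localOp A β) α := by
    have h3 := key α β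
    have h4 := key β α
    simp only [mul_comm (S.coroot _ (α : X))] at h3
    exact mul_left_cancel₀ two_ne_zero (h3.trans h4.symm)
  have h3 : (hS.localEigenvalue A α : K) * hS.localForm A α β =
      hS.localEigenvalue A β * hS.localForm A α β := by
    have h4 := congrArg (fun z => hS.localForm A z β) (hS.two_smul_localOp hα h2)
    have h5 := congrArg (fun z => hS.localForm A z α) (hS.two_smul_localOp hβ h1)
    simp only [map_smul, LinearMap.smul_apply, smul_eq_mul] at h4 h5
    rw [← h4, hsymm, h5, hS.localForm_comm]
  have h4 : hS.localForm A α β ≠ 0 := by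
    intro h4
    have := hS.two_mul_localForm hβ h1 α
    rw [h4, mul_zero] at this
    exact mul_ne_zero h (hS.localForm_self_ne_zero hβ h1) this.symm
  exact_mod_cast mul_right_cancel₀ h4 h3

/-- Every vector is a combination of roots with coefficients that are nonnegative rational
multiples of the values of the coroots. -/
theorem exists_eq_sum_coroot_smul (hS : S.IsLocallyFiniteRootSystem) (x : X) :
    ∃ (F : Finset S.roots) (d : S.roots → ℚ), (∀ γ, 0 ≤ d γ) ∧
      x = ∑ γ ∈ F, ((d γ : K) * S.coroot γ x) • (γ : X) := by
  obtain ⟨A, hA⟩ := S.exists_mem_rootSpan x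
  -- At `γ = 0` the eigenvalue is 0 and the coefficient is `2 / 0 = 0`.
  refine ⟨hS.rootsIn A, fun γ => 2 / hS.localEigenvalue A γ, fun γ => ?_, ?_⟩
  · have : (0 : ℚ) ≤ hS.localEigenvalue A γ := by exact_mod_cast hS.localEigenvalue_nonneg A γ
    positivity
  · induction hA using Submodule.span_induction with
    | mem x hx =>
      obtain ⟨α, hα, rfl⟩ := hx
      have hα' : α ∈ hS.rootsIn A := hS.mem_rootsIn.2 (mem_rootSpan hα)
      by_cases h : S.s α = 1
      · have h0 : (α : X) = 0 := by
          by_contra h0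
          exact hS.real_iff_ne_zero.2 h0 h
        simp [h0]
      -- The eigenvalue relation has the coefficient `2 / ℓ_α`. Replacing it by `2 / ℓ_γ`,
      -- legitimate wherever `⟨α, γ^∨⟩ ≠ 0`, makes the formula linear in `α`, so that it extends
      -- from roots to their span.
      have h1 : ∀ γ ∈ hS.rootsIn A,
          (((2 / hS.localEigenvalue A γ : ℚ) : K) * S.coroot γ α) • (γ : X) =
          (2 / hS.localEigenvalue A α : K) • (S.coroot γ α • (γ : X)) := by
        intro γ hγ
        by_cases h2 : S.coroot γ α = 0
        · simp [h2]
        · rw [← hS.localEigenvalue_eq hα' hγ h2, smul_smul]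
          push_cast
          rfl
      rw [Finset.sum_congr rfl h1, ← Finset.smul_sum, ← localOp_apply, div_eq_inv_mul,
        mul_smul, hS.two_smul_localOp hα' h, smul_smul, inv_mul_cancel₀, one_smul]
      exact_mod_cast (hS.localEigenvalue_pos hα' h).ne'
    | zero => simp
    | add x y _ _ hx hy =>
      simp only [map_add, mul_add, add_smul, Finset.sum_add_distrib]
      rw [← hx, ← hy]
    | smul c x _ hx =>
      have : ∀ γ : S.roots, ∀ d : K, (d * S.coroot γ (c • x)) • (γ : X) =
          c • ((d * S.coroot γ x) • (γ : X)) := by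
        intro γ d
        rw [map_smul, smul_smul, smul_eq_mul]
        congr 1
        ring
      simp only [this]
      rw [← Finset.smul_sum, ← hx]

theorem eq_zero_of_coroot_eq_zero (hS : S.IsLocallyFiniteRootSystem) {x : X}
    (h : ∀ γ : S.roots, S.coroot γ x = 0) : x = 0 := by
  obtain ⟨F, d, -, hx⟩ := hS.exists_eq_sum_coroot_smul x
  rw [hx]
  simp [h]

/-- Across one edge the ratio of the lengths is a ratio of pairings and so independent of `B`; along
a chain these ratios multiply. The set `A` need only contain the chain. -/
theorem exists_localForm_eq_mul (hS : S.IsLocallyFiniteRootSystem) {α β : S.roots}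
    (h : Relation.EqvGen (fun γ δ : S.roots => S.coroot γ (δ : X) ≠ 0) α β) :
    ∃ r : K, r ≠ 0 ∧ ∃ A : Finset S.roots, ∀ B, A ⊆ B →
      hS.localForm B β β = r * hS.localForm B α α := by
  classical
  induction h with
  | rel α β h =>
    have h' : S.coroot β (α : X) ≠ 0 := by
      intro h1
      apply h
      rw [hS.coroot_apply] at h1 ⊢
      exact_mod_cast hS.pairingInt_eq_zero_comm (by exact_mod_cast h1)
    refine ⟨S.coroot α β / S.coroot β α, div_ne_zero h h', {α, β}, fun B hB => ?_⟩
    have hα : α ∈ hS.rootsIn B := hS.mem_rootsIn.2 (mem_rootSpan (hB (by simp)))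
    have hβ : β ∈ hS.rootsIn B := hS.mem_rootsIn.2 (mem_rootSpan (hB (by simp)))
    have := hS.localForm_symmetrizes hα hβ
    field_simp
    linear_combination this
  | refl α => exact ⟨1, one_ne_zero, ∅, fun _ _ => by simp⟩
  | symm α β _ ih =>
    obtain ⟨r, hr, A, hA⟩ := ih
    exact ⟨r⁻¹, inv_ne_zero hr, A, fun B hB => by rw [hA B hB, inv_mul_cancel_left₀ hr]⟩
  | trans α β γ _ _ ih ih' =>
    obtain ⟨r, hr, A, hA⟩ := ih
    obtain ⟨r', hr', A', hA'⟩ := ih'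
    refine ⟨r' * r, mul_ne_zero hr' hr, A ∪ A', fun B hB => ?_⟩
    rw [hA' B (Finset.union_subset_right hB), hA B (Finset.union_subset_left hB), mul_assoc]

/-- The pairing of the roots and coroots of a locally finite root system is symmetrizable. -/
theorem exists_symmetrizer (hS : S.IsLocallyFiniteRootSystem) :
    ∃ q : S.roots → K, (∀ α β : S.roots, q β * S.coroot β α = q α * S.coroot α β) ∧
      ∀ α, q α ≠ 0 := by
  classical
  let E : S.roots → S.roots → Prop := fun γ δ => S.coroot γ (δ : X) ≠ 0
  -- Each component has a reference root `ρ α`, and `q α` is the stable ratio of the length of `α`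
  -- to that of `ρ α`.
  let ρ : S.roots → S.roots := fun α => (Quot.mk E α).out
  have hρ : ∀ α, Relation.EqvGen E (ρ α) α := fun α =>
    Quot.eqvGen_exact (Quot.out_eq (Quot.mk E α))
  choose q hq0 A hA using fun α => hS.exists_localForm_eq_mul (hρ α)
  refine ⟨q, ?_, hq0⟩
  have key : ∀ α β : S.roots, S.coroot α β ≠ 0 →
      q β * S.coroot β α = q α * S.coroot α β := by
    intro α β h
    have hE : ρ α = ρ β := congrArg Quot.out (Quot.sound h)
    -- In `B` both ratios are valid, and the length of the common reference root cancels.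
    let B := {α, β} ∪ (A α ∪ A β)
    have hα : α ∈ hS.rootsIn B := hS.mem_rootsIn.2 (mem_rootSpan (by simp [B]))
    have hβ : β ∈ hS.rootsIn B := hS.mem_rootsIn.2 (mem_rootSpan (by simp [B]))
    have h1 := hA α B fun x hx => by simp [B, hx]
    have h2 := hA β B fun x hx => by simp [B, hx]
    have h3 := hS.localForm_symmetrizes hα hβ
    have h4 := hS.localForm_self_ne_zero hα (S.real_of_coroot_apply_ne_zero h)
    rw [← hE] at h2
    rw [h1] at h4
    rw [h1, h2] at h3
    refine mul_right_cancel₀ (right_ne_zero_of_mul h4) ?_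
    linear_combination h3
  intro α β
  by_cases h : S.coroot α β = 0
  · by_cases h' : S.coroot β α = 0
    · rw [h, h', mul_zero, mul_zero]
    · exact (key β α h').symm
  · exact key α β h

end IsLocallyFiniteRootSystem

end LocallyFinite

/-! ### Coroots of a system built from prescribed coroots -/

section OfCoroots

variable {K : Type u} {X : Type v} [Field K] [CharZero K] [AddCommGroup X] [Module K X]

theorem coroot_ofCoroots (Φ : Set X) (φ : Φ → Dual K X) (h0 : (0 : X) ∈ Φ)
    (hspan : Submodule.span K Φ = ⊤) (h2 : ∀ α, φ α ≠ 0 → φ α (α : X) = 2)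
    (hre : ∀ α β : Φ, φ β ≠ 0 → ∃ h : (β : X) - φ α β • (α : X) ∈ Φ, φ ⟨_, h⟩ ≠ 0)
    (him : ∀ α β : Φ, φ β = 0 → ∃ h : (β : X) - φ α β • (α : X) ∈ Φ, φ ⟨_, h⟩ = 0) (α : Φ) :
    (ofCoroots Φ φ h0 hspan h2 hre him).coroot α = φ α := by
  by_cases h : φ α = 0
  · rw [h]
    exact coroot_eq_zero _ ((corootReflection_eq_one_iff (h2 α)).2 h)
  · exact coroot_eq _ (fun h1 => h ((corootReflection_eq_one_iff (h2 α)).1 h1))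
      fun x => corootReflection_apply (h2 α) x

end OfCoroots

/-! ### Extensions: pulling coroots, integrality, bounds and forms back from the quotient -/

section Extension

variable {K : Type u} {X : Type v} {Y : Type w} [Field K] [AddCommGroup X] [Module K X]
  [AddCommGroup Y] [Module K Y] {R : PreReflectionSystem K X} {S : PreReflectionSystem K Y}
  {f : X →ₗ[K] Y}

namespace IsExtension

/-- The root `f(α)`. -/
def map (hf : R.IsExtension S f) (α : R.roots) : S.roots :=
  ⟨f α, hf.1.elim fun h _ => h α⟩

@[simp] theorem coe_map (hf : R.IsExtension S f) (α : R.roots) : (hf.map α : Y) = f α := rfl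

theorem map_s (hf : R.IsExtension S f) (α : R.roots) (x : X) :
    f (R.s α x) = S.s (hf.map α) (f x) := by
  have h : f ∘ₗ (R.s α : X →ₗ[K] X) = (S.s (hf.map α) : Y →ₗ[K] Y) ∘ₗ f :=
    R.linearMap_ext fun β => hf.1.elim fun _ h => h α β
  exact LinearMap.congr_fun h x

theorem s_map_ne_one (hf : R.IsExtension S f) {α : R.roots} (h : R.s α ≠ 1) :
    S.s (hf.map α) ≠ 1 :=
  (S.mem_realRoots_iff (hf.map α)).1
    (hf.2.2.subset ⟨α, (R.mem_realRoots_iff α).2 h, rfl⟩)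

theorem s_map_eq_one (hf : R.IsExtension S f) {α : R.roots} (h : R.s α = 1) :
    S.s (hf.map α) = 1 :=
  (S.mem_imRoots_iff (hf.map α)).1
    (hf.2.1.subset ⟨α, (R.mem_imRoots_iff α).2 h, rfl⟩)

theorem coroot_map (hf : R.IsExtension S f) (α : R.roots) (x : X) :
    S.coroot (hf.map α) (f x) = R.coroot α x := by
  by_cases h : R.s α = 1
  · rw [R.coroot_eq_zero h, S.coroot_eq_zero (hf.s_map_eq_one h)]
    simp
  · have h1 := hf.map_s α x
    rw [R.s_apply, S.s_apply, map_sub, map_smul, sub_right_inj] at h1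
    exact smul_left_injective K (S.coe_ne_zero (hf.s_map_ne_one h)) h1.symm

theorem exists_map_eq (hf : R.IsExtension S f) (y : S.roots) : ∃ α, hf.map α = y := by
  by_cases h : S.s y = 1
  · obtain ⟨x, hx, h1⟩ := hf.2.1.superset ((S.mem_imRoots_iff y).2 h)
    exact ⟨⟨x, R.imRoots_subset hx⟩, Subtype.ext h1⟩
  · obtain ⟨x, hx, h1⟩ := hf.2.2.superset ((S.mem_realRoots_iff y).2 h)
    exact ⟨⟨x, R.realRoots_subset hx⟩, Subtype.ext h1⟩

theorem surjective (hf : R.IsExtension S f) : Function.Surjective f := by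
  rw [← LinearMap.range_eq_top, eq_top_iff, ← S.span_roots, Submodule.span_le]
  intro y hy
  obtain ⟨α, h⟩ := hf.exists_map_eq ⟨y, hy⟩
  exact ⟨α, congrArg Subtype.val h⟩

theorem isIntegral (hf : R.IsExtension S f) (hS : S.IsIntegral) : R.IsIntegral := by
  intro α β
  obtain ⟨n, hn⟩ := hS (hf.map α) (hf.map β)
  exact ⟨n, by rw [← hf.coroot_map]; exact hn⟩

variable [CharZero K]

/-- Coroots of `R` factor through `f`, and those of `S` separate the points of `Y`. -/
theorem mem_ker_iff_coroot (hf : R.IsExtension S f) (hS : S.IsLocallyFiniteRootSystem) {x : X} :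
    x ∈ LinearMap.ker f ↔ ∀ α : R.roots, R.coroot α x = 0 := by
  rw [LinearMap.mem_ker]
  constructor
  · intro h α
    rw [← hf.coroot_map, h, map_zero]
  · intro h
    refine hS.eq_zero_of_coroot_eq_zero fun y => ?_
    obtain ⟨α, rfl⟩ := hf.exists_map_eq y
    rw [hf.coroot_map, h]

theorem ker_eq_ker (hf : R.IsExtension S f) (hS : S.IsLocallyFiniteRootSystem)
    {b : LinearMap.BilinForm K X} (hb : R.IsAffineForm b) :
    LinearMap.ker b = LinearMap.ker f := by
  ext x
  rw [hf.mem_ker_iff_coroot hS, hb.mem_ker_iff_coroot]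

theorem hasBoundedCorootValues (hf : R.IsExtension S f) (hS : S.IsLocallyFiniteRootSystem) :
    R.HasBoundedCorootValues := by
  intro α _
  refine ⟨4, fun β n hn => ?_⟩
  have h1 := hS.coroot_apply (hf.map α) (hf.map β)
  rw [hf.coe_map, hf.coroot_map, hn] at h1
  have h2 : n = hS.pairingInt (hf.map α) (hf.map β) := by exact_mod_cast h1
  rw [h2]
  exact hS.abs_pairingInt_le _ _

theorem exists_affineForm (hf : R.IsExtension S f) (hS : S.IsLocallyFiniteRootSystem) :
    ∃ b : LinearMap.BilinForm K X, R.IsAffineForm b := by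
  obtain ⟨q, hq, hq0⟩ := hS.exists_symmetrizer
  obtain ⟨b, hb, -⟩ := R.exists_affineForm_of_symmetrizer (fun α => q (hf.map α))
    (fun α β => by
      rw [← hf.coroot_map, ← hf.coroot_map]
      exact hq (hf.map α) (hf.map β)) (fun α _ => hq0 _)
  exact ⟨b, hb⟩

end IsExtension

end Extension

/-! ### The quotient by the radical of an affine form -/

section Quotient

variable {K : Type u} {X : Type v} [Field K] [AddCommGroup X] [Module K X]
  {R : PreReflectionSystem K X} {b : LinearMap.BilinForm K X}

namespace IsAffineForm

theorem eq_one_of_mem_ker (hb : R.IsAffineForm b) {α : R.roots}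
    (h : (α : X) ∈ LinearMap.ker b) : R.s α = 1 :=
  (R.mem_imRoots_iff α).1 (hb.2.2.superset ⟨α.2, h⟩)

/-- A root of `R` lying over a given element of its image. -/
noncomputable def quotientLift (_ : R.IsAffineForm b)
    (y : (LinearMap.ker b).mkQ '' R.roots) : R.roots := ⟨y.2.choose, y.2.choose_spec.1⟩

theorem mkQ_quotientLift (hb : R.IsAffineForm b) (y : (LinearMap.ker b).mkQ '' R.roots) :
    (LinearMap.ker b).mkQ (hb.quotientLift y) = y := y.2.choose_spec.2

variable [CharZero K]

/-- The value `⟨x, α^∨⟩ = 2 b(x, α) / b(α, α)` at a real root depends on `α` modulo the radical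
only. This makes the choice in `quotientLift` harmless. -/
theorem coroot_eq_coroot (hb : R.IsAffineForm b) {α β : R.roots}
    (h : (LinearMap.ker b).mkQ α = (LinearMap.ker b).mkQ β) : R.coroot α = R.coroot β := by
  have h1 : (α : X) - β ∈ LinearMap.ker b := by
    rwa [Submodule.mkQ_apply, Submodule.mkQ_apply, Submodule.Quotient.eq] at h
  have h2 : b α = b β := by
    rw [← sub_eq_zero, ← map_sub]
    exact h1
  have h3 : ∀ x, b x α = b x β := fun x => by rw [hb.apply_comm, h2, hb.apply_comm]
  by_cases h4 : R.s α = 1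
  · have h5 : R.s β = 1 := by
      apply hb.eq_one_of_mem_ker
      have := hb.mem_ker_of_eq_one h4
      rwa [LinearMap.mem_ker, h2] at this
    rw [R.coroot_eq_zero h4, R.coroot_eq_zero h5]
  · ext x
    have h5 := hb.two_mul_apply α x
    rw [h3, hb.two_mul_apply β x, ← h3, ← h2] at h5
    exact mul_right_cancel₀ (hb.apply_self_ne_zero h4) h5.symm

/-- The linear form induced by a coroot on the quotient by the radical of an affine form. -/
noncomputable def quotientCoroot (hb : R.IsAffineForm b) (α : R.roots) : Dual K (X ⧸ LinearMap.ker b) :=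
  (LinearMap.ker b).liftQ (R.coroot α) fun _ hx => hb.mem_ker_iff_coroot.1 hx α

@[simp] theorem quotientCoroot_mkQ (hb : R.IsAffineForm b) (α : R.roots) (x : X) :
    hb.quotientCoroot α ((LinearMap.ker b).mkQ x) = R.coroot α x :=
  Submodule.liftQ_apply _ _ _

theorem quotientCoroot_eq_zero_iff (hb : R.IsAffineForm b) {α : R.roots} :
    hb.quotientCoroot α = 0 ↔ R.s α = 1 := by
  constructor
  · intro h
    refine R.s_eq_one_of_coroot (LinearMap.ext fun x => ?_)
    rw [← hb.quotientCoroot_mkQ, h]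
    rfl
  · intro h
    simp only [quotientCoroot, R.coroot_eq_zero h]
    ext x
    simp

theorem quotientCoroot_lift (hb : R.IsAffineForm b) (α : R.roots)
    (h : (LinearMap.ker b).mkQ α ∈ (LinearMap.ker b).mkQ '' R.roots) :
    hb.quotientCoroot (hb.quotientLift ⟨_, h⟩) = hb.quotientCoroot α := by
  have := hb.coroot_eq_coroot (hb.mkQ_quotientLift ⟨_, h⟩)
  simp only [quotientCoroot, this]

theorem sub_quotientCoroot_smul (hb : R.IsAffineForm b) (α β : R.roots) :
    (LinearMap.ker b).mkQ β - hb.quotientCoroot α ((LinearMap.ker b).mkQ β) •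
      (LinearMap.ker b).mkQ (α : X) = (LinearMap.ker b).mkQ (R.reflect α β) := by
  rw [hb.quotientCoroot_mkQ, coe_reflect, R.s_apply, map_sub, map_smul]

/-- The system induced on the quotient by the radical of an affine form. -/
noncomputable def quotientSystem (hb : R.IsAffineForm b) :
    PreReflectionSystem K (X ⧸ LinearMap.ker b) :=
  ofCoroots ((LinearMap.ker b).mkQ '' R.roots) (fun y => hb.quotientCoroot (hb.quotientLift y))
    ⟨0, R.zero_mem, map_zero _⟩
    (by rw [Submodule.span_image, R.span_roots, Submodule.map_top, Submodule.range_mkQ])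
    (fun y h => by
      rw [ne_eq, quotientCoroot_eq_zero_iff] at h
      rw [← hb.mkQ_quotientLift y, hb.quotientCoroot_mkQ, R.coroot_self h])
    (fun y z h => by
      rw [ne_eq, quotientCoroot_eq_zero_iff] at h
      rw [← hb.mkQ_quotientLift y, ← hb.mkQ_quotientLift z,
        sub_quotientCoroot_smul]
      refine ⟨Set.mem_image_of_mem _ (Subtype.coe_prop _), ?_⟩
      rw [hb.quotientCoroot_lift, ne_eq, quotientCoroot_eq_zero_iff]
      exact R.s_reflect_ne_one _ h)
    (fun y z h => by
      rw [quotientCoroot_eq_zero_iff] at h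
      rw [← hb.mkQ_quotientLift y, ← hb.mkQ_quotientLift z,
        sub_quotientCoroot_smul]
      refine ⟨Set.mem_image_of_mem _ (Subtype.coe_prop _), ?_⟩
      rw [hb.quotientCoroot_lift, quotientCoroot_eq_zero_iff]
      exact R.s_reflect_eq_one _ h)

theorem coroot_quotientSystem (hb : R.IsAffineForm b) (α : R.roots)
    (h : (LinearMap.ker b).mkQ α ∈ hb.quotientSystem.roots) :
    hb.quotientSystem.coroot ⟨_, h⟩ = hb.quotientCoroot α :=
  (coroot_ofCoroots _ _ _ _ _ _ _ _).trans (hb.quotientCoroot_lift α h)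

theorem s_quotientSystem_eq_one_iff (hb : R.IsAffineForm b) (α : R.roots)
    (h : (LinearMap.ker b).mkQ α ∈ hb.quotientSystem.roots) :
    hb.quotientSystem.s ⟨_, h⟩ = 1 ↔ R.s α = 1 := by
  rw [← hb.quotientCoroot_eq_zero_iff, ← hb.coroot_quotientSystem α h]
  exact ⟨coroot_eq_zero _, s_eq_one_of_coroot _⟩

theorem isExtension_mkQ (hb : R.IsAffineForm b) :
    R.IsExtension hb.quotientSystem (LinearMap.ker b).mkQ := by
  have hmem : ∀ α : R.roots, (LinearMap.ker b).mkQ α ∈ hb.quotientSystem.roots :=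
    fun α => ⟨α, α.2, rfl⟩
  refine ⟨⟨hmem, fun α β => ?_⟩, ?_, ?_⟩
  · rw [s_apply hb.quotientSystem, coroot_quotientSystem, sub_quotientCoroot_smul, coe_reflect]
  · ext y
    constructor
    · rintro ⟨x, ⟨hx, h⟩, rfl⟩
      exact ⟨⟨x, hx, rfl⟩, (hb.s_quotientSystem_eq_one_iff ⟨x, hx⟩ _).2 h⟩
    · rintro ⟨⟨x, hx, rfl⟩, h⟩
      exact ⟨x, ⟨hx, (hb.s_quotientSystem_eq_one_iff ⟨x, hx⟩ _).1 h⟩, rfl⟩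
  · ext y
    constructor
    · rintro ⟨x, ⟨hx, h⟩, rfl⟩
      exact ⟨⟨x, hx, rfl⟩, fun h1 => h ((hb.s_quotientSystem_eq_one_iff ⟨x, hx⟩ _).1 h1)⟩
    · rintro ⟨⟨x, hx, rfl⟩, h⟩
      exact ⟨x, ⟨hx, fun h1 => h ((hb.s_quotientSystem_eq_one_iff ⟨x, hx⟩ _).2 h1)⟩, rfl⟩

theorem eq_zero_of_quotientCoroot_eq_zero (hb : R.IsAffineForm b) {y : X ⧸ LinearMap.ker b}
    (h : ∀ α, hb.quotientCoroot α y = 0) : y = 0 := by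
  obtain ⟨x, rfl⟩ := (LinearMap.ker b).mkQ_surjective y
  simp only [quotientCoroot_mkQ] at h
  rw [Submodule.mkQ_apply, Submodule.Quotient.mk_eq_zero]
  exact hb.mem_ker_iff_coroot.2 h

/-- The coroots separate points, and their restrictions to `V` span a finite-dimensional space, so
finitely many of them already span it. -/
theorem exists_finset_injOn (hb : R.IsAffineForm b) (V : Submodule K (X ⧸ LinearMap.ker b))
    [FiniteDimensional K V] : ∃ A : Finset R.roots, ∀ y ∈ V,
      (∀ α ∈ A, hb.quotientCoroot α y = 0) → y = 0 := by
  classical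
  let g : R.roots → Dual K V := fun α => (hb.quotientCoroot α).domRestrict V
  obtain ⟨t, ht, hspan⟩ := (Submodule.fg_span_iff_fg_span_finset_subset _).1
    (IsNoetherian.noetherian (Submodule.span K (g '' Set.univ)))
  obtain ⟨A, -, rfl⟩ := Finset.subset_set_image_iff.1 ht
  refine ⟨A, fun y hy h => hb.eq_zero_of_quotientCoroot_eq_zero fun α => ?_⟩
  have h1 : g α ∈ Submodule.span K (A.image g : Set (Dual K V)) :=
    hspan ▸ Submodule.subset_span ⟨α, trivial, rfl⟩
  have h2 : Submodule.span K (A.image g : Set (Dual K V)) ≤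
      LinearMap.ker (LinearMap.applyₗ (R := K) (M₂ := K) (⟨y, hy⟩ : V)) := by
    rw [Submodule.span_le]
    intro φ hφ
    obtain ⟨β, hβ, rfl⟩ := Finset.mem_image.1 (Finset.mem_coe.1 hφ)
    exact h β hβ
  exact h2 h1

theorem isLocallyFinite_quotientSystem (hb : R.IsAffineForm b) (hI : R.IsIntegral)
    (hB : R.HasBoundedCorootValues) : hb.quotientSystem.IsLocallyFiniteRootSystem := by
  have hf := hb.isExtension_mkQ
  refine ⟨fun y z => ?_, ?_, fun V _ => ?_⟩
  · obtain ⟨α, rfl⟩ := hf.exists_map_eq y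
    obtain ⟨β, rfl⟩ := hf.exists_map_eq z
    obtain ⟨n, hn⟩ := hI α β
    exact ⟨n, by rw [hf.coe_map, hf.coroot_map, hn]⟩
  · ext y
    constructor
    · intro hy
      obtain ⟨α, h⟩ := hf.exists_map_eq ⟨y, hy⟩
      obtain rfl : (LinearMap.ker b).mkQ α = y := congrArg Subtype.val h
      by_cases h1 : R.s α = 1
      · right
        rw [Set.mem_singleton_iff, Submodule.mkQ_apply, Submodule.Quotient.mk_eq_zero]
        exact hb.mem_ker_of_eq_one h1
      · left
        exact hf.2.2.subset ⟨α, (R.mem_realRoots_iff α).2 h1, rfl⟩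
    · rintro (h | rfl)
      · exact realRoots_subset _ h
      · exact zero_mem _
  · obtain ⟨A, hA⟩ := hb.exists_finset_injOn V
    have hN : ∀ α : R.roots, {c : K | ∃ β : R.roots, R.coroot α β = c}.Finite := by
      intro α
      by_cases h : R.s α = 1
      · refine (Set.finite_singleton (0 : K)).subset ?_
        rintro _ ⟨β, rfl⟩
        simp [R.coroot_eq_zero h]
      · obtain ⟨N, hN⟩ := hB α ((R.mem_realRoots_iff α).2 h)
        refine ((Set.finite_Icc (-N : ℤ) N).image (fun n : ℤ => (n : K))).subset ?_
        rintro _ ⟨β, rfl⟩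
        obtain ⟨n, hn⟩ := hI α β
        exact ⟨n, abs_le.1 (hN β n hn), hn.symm⟩
    -- A root in `V` is determined by its values at the finitely many coroots from `A`, each of
    -- which takes finitely many values on roots.
    refine Set.Finite.of_finite_image (f := fun y (α : A) => hb.quotientCoroot α y)
      ((Set.Finite.pi fun α : A => hN α).subset ?_) ?_
    · rintro _ ⟨y, ⟨⟨x, hx, rfl⟩, -⟩, rfl⟩ α -
      exact ⟨⟨x, hx⟩, (hb.quotientCoroot_mkQ _ _).symm⟩
    · rintro y ⟨-, hy⟩ z ⟨-, hz⟩ h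
      rw [← sub_eq_zero]
      refine hA _ (V.sub_mem hy hz) fun α hα => ?_
      rw [map_sub, sub_eq_zero]
      exact congrFun h ⟨α, hα⟩

end IsAffineForm

end Quotient

/-! ### Connectedness of the real part and its transfer along extensions -/

section Connected

variable {K : Type u} {X : Type v} {Y : Type w} [Field K] [AddCommGroup X]
  [Module K X] [AddCommGroup Y] [Module K Y] {R : PreReflectionSystem K X}
  {S : PreReflectionSystem K Y} {f : X →ₗ[K] Y} {b : LinearMap.BilinForm K X}

theorem realPartConnected_iff_forall : R.RealPartConnected ↔
    R.realRoots.Nonempty ∧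
      ∀ α β : R.roots, R.s α ≠ 1 → R.s β ≠ 1 → R.ConnectedRoots α β := by
  constructor
  · rintro ⟨C, ⟨α₀, hα₀, -⟩, hC⟩
    refine ⟨⟨α₀, hα₀⟩, fun α β hα hβ => ?_⟩
    have h1 := hC _ ⟨α, (R.mem_realRoots_iff α).2 hα, rfl⟩
    have h2 := hC _ ⟨β, (R.mem_realRoots_iff β).2 hβ, rfl⟩
    have h3 := (h2.trans h1.symm).subset
      (Or.inr ⟨(R.mem_realRoots_iff β).2 hβ, β.2, Relation.ReflTransGen.refl⟩)
    rcases h3 with h3 | ⟨_, _, h3⟩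
    · exact absurd h3 (R.coe_ne_zero hβ)
    · exact h3
  · rintro ⟨⟨x, hx⟩, h⟩
    refine ⟨_, ⟨⟨x, hx.1⟩, hx, rfl⟩, ?_⟩
    rintro _ ⟨β, hβ, rfl⟩
    congr 1
    ext y
    refine and_congr_right fun hy => exists_congr fun h1 => ?_
    have hy' := (R.mem_realRoots_iff ⟨y, h1⟩).1 hy
    exact ⟨fun _ => h _ _ hx.2 hy', fun _ => h _ _ ((R.mem_realRoots_iff β).1 hβ) hy'⟩

theorem isIndecomposable_of_connected (hne : R.realRoots.Nonempty)
    (h : ∀ α β : R.roots, R.s α ≠ 1 → R.s β ≠ 1 → R.ConnectedRoots α β) :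
    R.IsIndecomposable := by
  refine ⟨hne, ?_⟩
  rintro ⟨X₁, X₂, _, _, _, _, R₁, R₂, e, he, ⟨a₁, h₁, h₁'⟩, ⟨a₂, h₂, h₂'⟩⟩
  have m₁ : e (a₁, 0) ∈ R.roots := he.roots_eq ▸ Or.inl ⟨a₁, h₁, rfl⟩
  have m₂ : e (0, a₂) ∈ R.roots := he.roots_eq ▸ Or.inr ⟨a₂, h₂, rfl⟩
  have r₁ : R.s ⟨_, m₁⟩ ≠ 1 := by
    intro h0
    apply h₁'
    ext x
    have := he.s_left ⟨a₁, h₁⟩ m₁ x 0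
    rw [h0] at this
    exact (Prod.ext_iff.1 (e.injective this)).1.symm
  have r₂ : R.s ⟨_, m₂⟩ ≠ 1 := by
    intro h0
    apply h₂'
    ext x
    have := he.s_right ⟨a₂, h₂⟩ m₂ 0 x
    rw [h0] at this
    exact (Prod.ext_iff.1 (e.injective this)).2.symm
  -- Reflections of the first summand fix the second, so a chain that starts in the first summand
  -- never leaves it.
  have key : ∀ γ : R.roots, R.ConnectedRoots ⟨_, m₁⟩ γ →
      ∃ c ∈ R₁.roots, (γ : X) = e (c, 0) := by
    intro γ hγ
    induction hγ with
    | refl => exact ⟨a₁, h₁, rfl⟩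
    | @tail γ δ _ hδ ih =>
      obtain ⟨c, hc, hγ⟩ := ih
      rcases he.roots_eq.subset δ.2 with ⟨d, hd, h3⟩ | ⟨d, hd, h3⟩
      · exact ⟨d, hd, h3.symm⟩
      · exfalso
        obtain ⟨γ, hγ'⟩ := γ
        obtain rfl : γ = e (c, 0) := hγ
        have h4 := he.s_left ⟨c, hc⟩ hγ' 0 d
        rw [map_zero, show e (0, d) = (δ : X) from h3, R.s_apply, sub_eq_self] at h4
        rcases smul_eq_zero.1 h4 with h5 | h5
        · exact hδ h5
        · exact R.coe_ne_zero (R.real_of_coroot_apply_ne_zero hδ) h5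
  obtain ⟨c, -, hc⟩ := key _ (h _ _ r₁ r₂)
  have := (Prod.ext_iff.1 (e.injective hc)).2
  exact R₂.coe_ne_zero h₂' this

variable [CharZero K]

namespace IsAffineForm

theorem connectedRoots_symm (hb : R.IsAffineForm b) {α β : R.roots}
    (h : R.ConnectedRoots α β) : R.ConnectedRoots β α :=
  have : Std.Symm fun γ δ : R.roots => R.coroot γ (δ : X) ≠ 0 :=
    ⟨fun _ _ h h' => h (hb.coroot_apply_eq_zero_comm h')⟩
  (Relation.ReflTransGen.stdSymm (r := fun γ δ : R.roots => R.coroot γ (δ : X) ≠ 0)).symm _ _ h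

theorem real_of_connectedRoots (hb : R.IsAffineForm b) {α β : R.roots}
    (h : R.ConnectedRoots α β) (hα : R.s α ≠ 1) : R.s β ≠ 1 := by
  induction h with
  | refl => exact hα
  | tail _ h _ =>
    exact R.real_of_coroot_apply_ne_zero fun h' => h (hb.coroot_apply_eq_zero_comm h')

end IsAffineForm

theorem IsExtension.connectedRoots_map_iff (hf : R.IsExtension S f) {α β : R.roots}
    (hα : R.s α ≠ 1) :
    S.ConnectedRoots (hf.map α) (hf.map β) ↔ R.ConnectedRoots α β := by
  constructor
  · intro h
    generalize hy : hf.map β = y at h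
    induction h generalizing β with
    | refl =>
      -- Two roots over the same image need not coincide, but their pairing is `⟨α, α^∨⟩ = 2`.
      refine Relation.ReflTransGen.single ?_
      have h1 : f β = f α := congrArg Subtype.val hy
      rw [← hf.coroot_map, h1, hf.coroot_map, R.coroot_self hα]
      exact two_ne_zero
    | @tail y z _ h ih =>
      obtain ⟨γ, hγ⟩ := hf.exists_map_eq y
      refine Relation.ReflTransGen.tail (ih hγ) ?_
      rw [← hf.coroot_map, hγ, ← hf.coe_map, hy]
      exact h
  · refine fun h => Relation.ReflTransGen.lift hf.map (fun γ δ h => ?_) _ _ h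
    change S.coroot (hf.map γ) (f δ) ≠ 0
    rwa [hf.coroot_map]

theorem IsLocallyFiniteRootSystem.exists_affineForm (hS : S.IsLocallyFiniteRootSystem) :
    ∃ b : LinearMap.BilinForm K Y, S.IsAffineForm b := by
  obtain ⟨q, hq, hq0⟩ := hS.exists_symmetrizer
  obtain ⟨b, hb, -⟩ := S.exists_affineForm_of_symmetrizer q hq fun α _ => hq0 α
  exact ⟨b, hb⟩

theorem IsExtension.realPartConnected_iff (hf : R.IsExtension S f) :
    R.RealPartConnected ↔ S.RealPartConnected := by
  rw [realPartConnected_iff_forall, realPartConnected_iff_forall, ← hf.2.2, Set.image_nonempty]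
  refine and_congr_right fun _ => ⟨fun h y z hy hz => ?_, fun h α β hα hβ => ?_⟩
  · obtain ⟨α, rfl⟩ := hf.exists_map_eq y
    obtain ⟨β, rfl⟩ := hf.exists_map_eq z
    have hα : R.s α ≠ 1 := fun h => hy (hf.s_map_eq_one h)
    exact (hf.connectedRoots_map_iff hα).2 (h α β hα fun h => hz (hf.s_map_eq_one h))
  · exact (hf.connectedRoots_map_iff hα).1
      (h _ _ (hf.s_map_ne_one hα) (hf.s_map_ne_one hβ))

end Connected

/-! ### Splitting a locally finite system along a union of connected components -/

section Subsystem

variable {K : Type u} {X : Type v} [Field K] [AddCommGroup X] [Module K X]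

/-- The set of the roots with a property, together with zero. -/
def rootsWith (S : PreReflectionSystem K X) (P : S.roots → Prop) : Set X :=
  {x | ∃ h : x ∈ S.roots, x = 0 ∨ P ⟨x, h⟩}

/-- The span of the roots with a property. -/
def spanWith (S : PreReflectionSystem K X) (P : S.roots → Prop) : Submodule K X :=
  Submodule.span K (S.rootsWith P)

variable {S : PreReflectionSystem K X} {P Q : S.roots → Prop}

theorem reflect_of_closed
    (hP : ∀ γ δ : S.roots, S.coroot γ (δ : X) ≠ 0 → (P γ ↔ P δ)) {γ δ : S.roots}
    (hγ : P γ) (hδ : P δ) : P (S.reflect γ δ) := by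
  by_cases h : S.coroot γ (δ : X) = 0
  · have : S.reflect γ δ = δ := Subtype.ext (by rw [coe_reflect, S.s_apply, h]; simp)
    rwa [this]
  -- `⟨s_γ δ, γ^∨⟩ = -⟨δ, γ^∨⟩ ≠ 0`, so `γ` and `s_γ δ` are neighbours.
  · refine (hP γ _ ?_).1 hγ
    rw [coe_reflect, S.s_apply, map_sub, map_smul,
      S.coroot_self (S.real_of_coroot_apply_ne_zero h), smul_eq_mul]
    intro h1
    apply h
    linear_combination -h1

theorem coroot_eq_zero_of_mem_spanWith
    (hPQ : ∀ γ δ : S.roots, P γ → Q δ → S.coroot γ (δ : X) = 0) {a x : X}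
    (ha : a ∈ S.rootsWith P) (hx : x ∈ S.spanWith Q) : S.coroot ⟨a, ha.1⟩ x = 0 := by
  obtain ⟨h, rfl | h1⟩ := ha
  · rw [S.coroot_eq_zero (S.s_zero h)]
    rfl
  · suffices hle : S.spanWith Q ≤ LinearMap.ker (S.coroot ⟨a, h⟩) from hle hx
    rw [spanWith, Submodule.span_le]
    rintro y ⟨hy, rfl | h2⟩
    · exact (LinearMap.ker (S.coroot ⟨a, h⟩)).zero_mem
    · exact hPQ _ _ h1 h2

theorem real_of_domRestrict_ne_zero {α : S.roots} {V : Submodule K X}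
    (h : (S.coroot α).domRestrict V ≠ 0) : S.s α ≠ 1 := by
  intro h1
  apply h
  rw [S.coroot_eq_zero h1]
  rfl

variable [CharZero K]

/-- The roots with a property that is constant on connected components form a pre-reflection
system in their span. -/
noncomputable def subsystem (hS : S.IsLocallyFiniteRootSystem)
    (hP : ∀ γ δ : S.roots, S.coroot γ (δ : X) ≠ 0 → (P γ ↔ P δ)) :
    PreReflectionSystem K (S.spanWith P) :=
  ofCoroots {v : S.spanWith P | (v : X) ∈ S.rootsWith P}
    (fun v => (S.coroot ⟨v.1.1, v.2.1⟩).domRestrict (S.spanWith P))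
    ⟨S.zero_mem, Or.inl rfl⟩
    (Submodule.span_span_coe_preimage (R := K) (s := S.rootsWith P))
    (fun v h => S.coroot_self (real_of_domRestrict_ne_zero h))
    (fun v w h => by
      have hw := real_of_domRestrict_ne_zero h
      have hs : ((w.1 : X) - S.coroot ⟨v.1.1, v.2.1⟩ w.1.1 • v.1.1) =
          S.s ⟨v.1.1, v.2.1⟩ w.1.1 := (S.s_apply ⟨v.1.1, v.2.1⟩ _).symm
      have hm : ((w.1 : X) - S.coroot ⟨v.1.1, v.2.1⟩ w.1.1 • v.1.1) ∈ S.rootsWith P := by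
        rw [hs]
        refine ⟨S.s_apply_mem _ ⟨w.1.1, w.2.1⟩, ?_⟩
        rcases v.2.2 with h1 | h1
        · right
          have h2 := w.2.2.resolve_left (S.coe_ne_zero hw)
          have h3 : S.reflect ⟨v.1.1, v.2.1⟩ ⟨w.1.1, w.2.1⟩ = ⟨w.1.1, w.2.1⟩ :=
            Subtype.ext (by rw [coe_reflect, S.s_apply]; simp [h1])
          change P (S.reflect ⟨v.1.1, v.2.1⟩ ⟨w.1.1, w.2.1⟩)
          rwa [h3]
        · rcases w.2.2 with h2 | h2
          · left
            rw [h2, map_zero]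
          · exact Or.inr (reflect_of_closed hP h1 h2)
      refine ⟨hm, fun h0 => ?_⟩
      have h3 : S.s ⟨_, hm.1⟩ ≠ 1 := by
        have := S.s_reflect_ne_one ⟨v.1.1, v.2.1⟩ hw
        convert this
        exact hs
      have h4 := S.coroot_self h3
      have h5 := LinearMap.congr_fun h0 (w.1 - S.coroot ⟨v.1.1, v.2.1⟩ w.1.1 • v.1)
      exact two_ne_zero (h4.symm.trans h5))
    (fun v w h => by
      -- A nonzero `w` is real, and its coroot takes the value 2 at `w`, which lies in the span; so
      -- restriction turns no real root imaginary.
      have hw : (w.1 : X) = 0 := by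
        by_contra h0
        have h1 : S.s ⟨w.1.1, w.2.1⟩ ≠ 1 := hS.real_iff_ne_zero.2 h0
        exact two_ne_zero ((S.coroot_self h1).symm.trans (LinearMap.congr_fun h w.1))
      obtain rfl : w = ⟨0, ⟨S.zero_mem, Or.inl rfl⟩⟩ := Subtype.ext (Subtype.ext hw)
      have h0 : (0 : S.spanWith P) - (S.coroot ⟨v.1.1, v.2.1⟩).domRestrict (S.spanWith P) 0 • v.1
          = 0 := by simp
      refine ⟨h0.symm ▸ ⟨S.zero_mem, Or.inl rfl⟩, ?_⟩
      convert h)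

theorem coroot_subsystem (hS : S.IsLocallyFiniteRootSystem)
    (hP : ∀ γ δ : S.roots, S.coroot γ (δ : X) ≠ 0 → (P γ ↔ P δ))
    (v : (subsystem hS hP).roots) :
    (subsystem hS hP).coroot v =
      (S.coroot ⟨v.1.1, v.2.1⟩).domRestrict (S.spanWith P) :=
  coroot_ofCoroots _ _ _ _ _ _ _ _

theorem realRoots_subsystem_nonempty (hS : S.IsLocallyFiniteRootSystem)
    (hP : ∀ γ δ : S.roots, S.coroot γ (δ : X) ≠ 0 → (P γ ↔ P δ)) {α : S.roots}
    (hα : S.s α ≠ 1) (h : P α) : (subsystem hS hP).realRoots.Nonempty := by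
  have h1 : (α : X) ∈ S.rootsWith P := ⟨α.2, Or.inr h⟩
  refine ⟨⟨α, Submodule.subset_span h1⟩, h1, ?_⟩
  rw [← coroot_ne_zero_iff, coroot_subsystem]
  intro h0
  exact two_ne_zero ((S.coroot_self hα).symm.trans
    (LinearMap.congr_fun h0 ⟨α, Submodule.subset_span h1⟩))

/-- A vector in both spans is killed by every coroot, since each coroot vanishes on the span to
which its root does not belong. -/
theorem isCompl_spanWith (hS : S.IsLocallyFiniteRootSystem)
    (hP : ∀ γ δ : S.roots, S.coroot γ (δ : X) ≠ 0 → (P γ ↔ P δ)) :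
    IsCompl (S.spanWith P) (S.spanWith fun γ => ¬ P γ) := by
  constructor
  · rw [Submodule.disjoint_def]
    intro x hx hx'
    refine hS.eq_zero_of_coroot_eq_zero fun γ => ?_
    by_cases h : P γ
    · exact coroot_eq_zero_of_mem_spanWith (P := P) (fun γ δ h1 h2 => by
        by_contra h3
        exact h2 ((hP γ δ h3).1 h1)) ⟨γ.2, Or.inr h⟩ hx'
    · exact coroot_eq_zero_of_mem_spanWith (P := fun γ => ¬ P γ) (fun γ δ h1 h2 => by
        by_contra h3
        exact h1 ((hP γ δ h3).2 h2)) ⟨γ.2, Or.inr h⟩ hx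
  · rw [codisjoint_iff, eq_top_iff, ← S.span_roots, Submodule.span_le]
    intro x hx
    by_cases h : P ⟨x, hx⟩
    · exact Submodule.mem_sup_left (Submodule.subset_span ⟨hx, Or.inr h⟩)
    · exact Submodule.mem_sup_right (Submodule.subset_span ⟨hx, Or.inr h⟩)

theorem isDirectSum_subsystem (hS : S.IsLocallyFiniteRootSystem)
    (hP : ∀ γ δ : S.roots, S.coroot γ (δ : X) ≠ 0 → (P γ ↔ P δ)) :
    S.IsDirectSum (subsystem hS hP)
      (subsystem (P := fun γ => ¬ P γ) hS fun γ δ h => not_congr (hP γ δ h))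
      (Submodule.prodEquivOfIsCompl _ _ (isCompl_spanWith hS hP)) where
  roots_eq := by
    ext x
    constructor
    · intro hx
      by_cases h : P ⟨x, hx⟩
      · have h1 : x ∈ S.rootsWith P := ⟨hx, Or.inr h⟩
        exact Or.inl ⟨⟨x, Submodule.subset_span h1⟩, h1, by simp⟩
      · have h1 : x ∈ S.rootsWith (fun γ => ¬ P γ) := ⟨hx, Or.inr h⟩
        exact Or.inr ⟨⟨x, Submodule.subset_span h1⟩, h1, by simp⟩
    · rintro (⟨y, hy, rfl⟩ | ⟨y, hy, rfl⟩)
      · simpa using hy.1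
      · simpa using hy.1
  s_left a h x y := by
    have h1 : S.coroot ⟨a.1.1, a.2.1⟩ y = 0 :=
      coroot_eq_zero_of_mem_spanWith (P := P) (fun γ δ h1 h2 => by
        by_contra h3
        exact h2 ((hP γ δ h3).1 h1)) a.2 y.2
    have h2 : (⟨_, h⟩ : S.roots) = ⟨a.1.1, a.2.1⟩ := Subtype.ext (by simp)
    rw [h2, S.s_apply, s_apply (subsystem hS hP), coroot_subsystem]
    simp [h1]
    abel
  s_right a h x y := by
    have h1 : S.coroot ⟨a.1.1, a.2.1⟩ x = 0 :=
      coroot_eq_zero_of_mem_spanWith (P := fun γ => ¬ P γ) (fun γ δ h1 h2 => by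
        by_contra h3
        exact h1 ((hP γ δ h3).2 h2)) a.2 x.2
    have h2 : (⟨_, h⟩ : S.roots) = ⟨a.1.1, a.2.1⟩ := Subtype.ext (by simp)
    rw [h2, S.s_apply, s_apply (subsystem (P := fun γ => ¬ P γ) hS _), coroot_subsystem]
    simp [h1]
    abel

theorem IsLocallyFiniteRootSystem.realPartConnected_iff_isIrreducible
    (hS : S.IsLocallyFiniteRootSystem) : S.RealPartConnected ↔ S.IsIrreducible := by
  obtain ⟨b, hb⟩ := hS.exists_affineForm
  rw [realPartConnected_iff_forall, IsIrreducible, and_iff_right hS]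
  refine ⟨fun h => isIndecomposable_of_connected h.1 h.2, fun h => ⟨h.1, fun α β hα hβ => ?_⟩⟩
  by_contra hαβ
  -- The property used for the splitting is connectedness to `α`; the second summand has a real root
  -- because of `β`.
  have hP : ∀ γ δ : S.roots, S.coroot γ (δ : X) ≠ 0 →
      (S.ConnectedRoots α γ ↔ S.ConnectedRoots α δ) := fun γ δ hγδ =>
    ⟨fun h => h.tail hγδ, fun h => h.tail fun h0 => hγδ (hb.coroot_apply_eq_zero_comm h0)⟩
  exact h.2 ⟨_, _, _, _, _, _, _, _, _, isDirectSum_subsystem hS hP,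
    realRoots_subsystem_nonempty hS hP hα Relation.ReflTransGen.refl,
    realRoots_subsystem_nonempty hS _ hβ hαβ⟩

end Subsystem

/-! ### Uniqueness of the quotient root system -/

section Isomorphism

variable {K : Type u} {X : Type v} {Y : Type w} [Field K] [AddCommGroup X] [Module K X]
  [AddCommGroup Y] [Module K Y] {R : PreReflectionSystem K X} {S : PreReflectionSystem K Y}
  {f : X →ₗ[K] Y}

theorem isIsomorphism_of_comp {Z : Type*} [AddCommGroup Z] [Module K Z]
    {T : PreReflectionSystem K Z} {g : X →ₗ[K] Z} (hf : R.IsExtension S f)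
    (hg : R.IsExtension T g) (e : Y ≃ₗ[K] Z) (he : ∀ x, e (f x) = g x) :
    S.IsIsomorphism T e := by
  have he' : ∀ x, e.symm (g x) = f x := fun x => by rw [← he, e.symm_apply_apply]
  have m : ∀ y : S.roots, e y ∈ T.roots := fun y => by
    obtain ⟨α, rfl⟩ := hf.exists_map_eq y
    rw [hf.coe_map, he]
    exact (hg.map α).2
  have m' : ∀ y : T.roots, e.symm y ∈ S.roots := fun y => by
    obtain ⟨α, rfl⟩ := hg.exists_map_eq y
    rw [hg.coe_map, he']
    exact (hf.map α).2
  refine ⟨⟨m, fun y z => ?_⟩, ⟨m', fun y z => ?_⟩⟩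
  · obtain ⟨α, rfl⟩ := hf.exists_map_eq y
    obtain ⟨β, rfl⟩ := hf.exists_map_eq z
    have h : (⟨_, m (hf.map α)⟩ : T.roots) = hg.map α := Subtype.ext (he α)
    refine Eq.trans ?_ (congrArg (fun u => T.s u (e (hf.map β))) h.symm)
    rw [hf.coe_map, ← hf.map_s, LinearEquiv.coe_coe, he, he, hg.map_s]
  · obtain ⟨α, rfl⟩ := hg.exists_map_eq y
    obtain ⟨β, rfl⟩ := hg.exists_map_eq z
    have h : (⟨_, m' (hg.map α)⟩ : S.roots) = hf.map α := Subtype.ext (he' α)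
    refine Eq.trans ?_ (congrArg (fun u => S.s u (e.symm (hg.map β))) h.symm)
    rw [hg.coe_map, ← hg.map_s, LinearEquiv.coe_coe, he', he', hf.map_s]

end Isomorphism

/-! ### Square lengths, the normalized form and its semidefiniteness -/

section Normalized

variable {K : Type u} {X : Type v} {Y : Type w} [Field K] [CharZero K] [AddCommGroup X]
  [Module K X] [AddCommGroup Y] [Module K Y] {R : PreReflectionSystem K X}
  {S : PreReflectionSystem K Y} {f : X →ₗ[K] Y} {b b' : LinearMap.BilinForm K X}

/-- Up to a common sign only the pairs `(1, k)`, `(k, 1)` and `(2, 2)` occur. Applied to opposite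
pairings, the quotient is the ratio of two square lengths. -/
theorem _root_.Int.eq_small_mul_of_mul_le_four {m n : ℤ} (hm : m ≠ 0) (hn : n ≠ 0)
    (h0 : 0 ≤ m * n) (h4 : m * n ≤ 4) (hm4 : |m| ≤ 4) :
    ∃ k : ℕ, 1 ≤ k ∧ k ≤ 4 ∧ (m = k * n ∨ n = k * m) := by
  obtain ⟨h1, h2⟩ := abs_le.1 hm4
  have : m = n ∨ m = 2 * n ∨ m = 3 * n ∨ m = 4 * n ∨ n = 2 * m ∨ n = 3 * m ∨ n = 4 * m := by
    interval_cases m <;> omega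
  rcases this with h | h | h | h | h | h | h
  · exact ⟨1, by simp, by simp, Or.inl (by simpa using h)⟩
  · exact ⟨2, by simp, by simp, Or.inl (by simpa using h)⟩
  · exact ⟨3, by simp, by simp, Or.inl (by simpa using h)⟩
  · exact ⟨4, by simp, by simp, Or.inl (by simpa using h)⟩
  · exact ⟨2, by simp, by simp, Or.inr (by simpa using h)⟩
  · exact ⟨3, by simp, by simp, Or.inr (by simpa using h)⟩
  · exact ⟨4, by simp, by simp, Or.inr (by simpa using h)⟩

theorem IsExtension.squareLength_ratio_of_coroot_ne_zero (hf : R.IsExtension S f)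
    (hS : S.IsLocallyFiniteRootSystem) (hb : R.IsAffineForm b) {α β : R.roots}
    (h : R.coroot α (β : X) ≠ 0) :
    ∃ k : ℕ, 1 ≤ k ∧ k ≤ 4 ∧ (b β β = k * b α α ∨ b α α = k * b β β) := by
  have h1 := hS.coroot_apply (hf.map α) (hf.map β)
  have h2 := hS.coroot_apply (hf.map β) (hf.map α)
  rw [hf.coe_map, hf.coroot_map] at h1 h2
  have h' : R.coroot β (α : X) ≠ 0 := fun h' => h (hb.coroot_apply_eq_zero_comm h')
  have hs := hb.symmetrizes α β
  obtain ⟨hb0, hb4⟩ := hS.pairingInt_mul_bounds (hf.map α) (hf.map β)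
  obtain ⟨k, hk1, hk4, hk⟩ := Int.eq_small_mul_of_mul_le_four
    (fun h0 => h (by rw [h1, h0, Int.cast_zero])) (fun h0 => h' (by rw [h2, h0, Int.cast_zero]))
    hb0 hb4 (hS.abs_pairingInt_le _ _)
  refine ⟨k, hk1, hk4, ?_⟩
  rcases hk with hk | hk
  · left
    refine mul_right_cancel₀ h' ?_
    rw [hs, h1, h2, hk]
    push_cast
    ring
  · right
    refine mul_right_cancel₀ h ?_
    rw [← hs, h1, h2, hk]
    push_cast
    ring

/-- Connected roots may be orthogonal, but `α` can be moved by reflections, which preserve its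
length, until it pairs nontrivially with `β`. This reduces length ratios in a component to the case
of neighbours. -/
theorem IsAffineForm.exists_coroot_ne_zero_of_connectedRoots (hb : R.IsAffineForm b)
    {α β : R.roots} (hα : R.s α ≠ 1) (h : R.ConnectedRoots α β) :
    ∃ α' : R.roots, b α' α' = b α α ∧ R.coroot α' (β : X) ≠ 0 := by
  induction h with
  | refl => exact ⟨α, rfl, by rw [R.coroot_self hα]; exact two_ne_zero⟩
  | @tail β γ _ hγ ih =>
    obtain ⟨α', h1, h2⟩ := ih
    by_cases h3 : R.coroot α' (γ : X) = 0
    -- As `α'` is orthogonal to `γ`, the pairing of `s_β α'` with `γ^∨` is `-⟨α', β^∨⟩⟨β, γ^∨⟩`,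
    -- which is nonzero.
    · refine ⟨R.reflect β α', by rw [coe_reflect, hb.apply_s_apply_s, h1], fun h4 => ?_⟩
      have h5 := hb.coroot_apply_eq_zero_comm h4
      rw [coe_reflect, R.s_apply, map_sub, hb.coroot_apply_eq_zero_comm h3, map_smul, zero_sub,
        neg_eq_zero, smul_eq_mul] at h5
      rcases mul_eq_zero.1 h5 with h6 | h6
      · exact h2 (hb.coroot_apply_eq_zero_comm h6)
      · exact hγ (hb.coroot_apply_eq_zero_comm h6)
    · exact ⟨α', h1, h3⟩

theorem IsExtension.squareLength_ratio (hf : R.IsExtension S f)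
    (hS : S.IsLocallyFiniteRootSystem) (hb : R.IsAffineForm b) {α β : R.roots}
    (hα : R.s α ≠ 1) (h : R.ConnectedRoots α β) :
    ∃ k : ℕ, 1 ≤ k ∧ k ≤ 4 ∧ (b β β = k * b α α ∨ b α α = k * b β β) := by
  obtain ⟨α', h1, h2⟩ := hb.exists_coroot_ne_zero_of_connectedRoots hα h
  rw [← h1]
  exact hf.squareLength_ratio_of_coroot_ne_zero hS hb h2

theorem IsExtension.exists_minimal_squareLength (hf : R.IsExtension S f)
    (hS : S.IsLocallyFiniteRootSystem) (hb : R.IsAffineForm b) {α : R.roots}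
    (hα : R.s α ≠ 1) :
    ∃ t : K, t ≠ 0 ∧ (∃ β, R.ConnectedRoots α β ∧ b β β = t) ∧
      ∀ β, R.ConnectedRoots α β → ∃ k : ℕ, 1 ≤ k ∧ k ≤ 4 ∧ b β β = k * t := by
  classical
  have hα0 := hb.apply_self_ne_zero hα
  -- 12 is the least common multiple of 1, 2, 3, 4; it makes all ratios natural numbers, so that a
  -- shortest length can be chosen although the field is not ordered.
  have hex : ∀ β, R.ConnectedRoots α β → ∃ n : ℕ, 0 < n ∧ 12 * b β β = n * b α α := by
    intro β h
    obtain ⟨k, hk1, hk4, hk | hk⟩ := hf.squareLength_ratio hS hb hα h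
    · exact ⟨12 * k, by positivity, by rw [hk]; push_cast; ring⟩
    · refine ⟨12 / k, by interval_cases k <;> simp, ?_⟩
      rw [hk]
      interval_cases k <;> push_cast <;> ring
  let P : ℕ → Prop := fun n => 0 < n ∧ ∃ β, R.ConnectedRoots α β ∧ 12 * b β β = n * b α α
  have hP : ∃ n, P n := by
    obtain ⟨n, hn, h⟩ := hex α Relation.ReflTransGen.refl
    exact ⟨n, hn, α, Relation.ReflTransGen.refl, h⟩
  obtain ⟨-, β₀, hβ₀, h0⟩ := Nat.find_spec hP
  have hr := hb.real_of_connectedRoots hβ₀ hα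
  refine ⟨b β₀ β₀, hb.apply_self_ne_zero hr, ⟨β₀, hβ₀, rfl⟩, fun β hβ => ?_⟩
  obtain ⟨k, hk1, hk4, hk | hk⟩ :=
    hf.squareLength_ratio hS hb hr ((hb.connectedRoots_symm hβ₀).trans hβ)
  · exact ⟨k, hk1, hk4, hk⟩
  · obtain ⟨n, hn, h⟩ := hex β hβ
    -- If the minimal length is `k` times another one, minimality forces `k = 1`.
    have h1 : (Nat.find hP : K) * b α α = ((k * n : ℕ) : K) * b α α := by
      rw [← h0, hk]
      push_cast
      linear_combination (k : K) * h
    have h2 : Nat.find hP = k * n := by exact_mod_cast mul_right_cancel₀ hα0 h1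
    have h3 : Nat.find hP ≤ n := Nat.find_le ⟨hn, β, hβ, h⟩
    have h4 : k = 1 := by
      rw [h2] at h3
      nlinarith
    exact ⟨1, le_rfl, by simp, by rw [hk, h4]; simp⟩

theorem IsAffineForm.mem_squareLengths_iff (hb : R.IsAffineForm b) {α : R.roots}
    (hα : R.s α ≠ 1) {t : K} :
    t ∈ squareLengths b ({0} ∪
      {x | x ∈ R.realRoots ∧ ∃ h : x ∈ R.roots, R.ConnectedRoots α ⟨x, h⟩}) ↔
      ∃ β, R.ConnectedRoots α β ∧ b β β = t := by
  constructor
  · rintro ⟨x, hx | ⟨-, hx, h⟩, h0, ht⟩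
    · exact absurd hx h0
    · exact ⟨⟨x, hx⟩, h, ht⟩
  · rintro ⟨β, hβ, ht⟩
    have hr := hb.real_of_connectedRoots hβ hα
    exact ⟨β, Or.inr ⟨(R.mem_realRoots_iff β).2 hr, β.2, hβ⟩, R.coe_ne_zero hr, ht⟩

theorem IsExtension.exists_normalized (hf : R.IsExtension S f)
    (hS : S.IsLocallyFiniteRootSystem) :
    ∃ b : LinearMap.BilinForm K X, R.IsAffineForm b ∧ R.IsNormalized b := by
  classical
  obtain ⟨b, hb⟩ := hf.exists_affineForm hS
  choose! t ht0 hmin hle using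
    fun (α : R.roots) (hα : R.s α ≠ 1) => hf.exists_minimal_squareLength hS hb hα
  -- Each of the two minimal lengths is a natural multiple of the other.
  have ht : ∀ α β, R.s α ≠ 1 → R.ConnectedRoots α β → t α = t β := by
    intro α β hα h
    have hβ := hb.real_of_connectedRoots h hα
    obtain ⟨γ, hγ, h1⟩ := hmin α hα
    obtain ⟨δ, hδ, h2⟩ := hmin β hβ
    obtain ⟨k, -, -, h3⟩ := hle β hβ γ ((hb.connectedRoots_symm h).trans hγ)
    obtain ⟨l, -, -, h4⟩ := hle α hα δ (h.trans hδ)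
    rw [h1] at h3
    rw [h2, h3] at h4
    have h5 : ((l * k : ℕ) : K) = (1 : ℕ) := by
      refine mul_right_cancel₀ (ht0 β hβ) ?_
      push_cast
      linear_combination -h4
    have h6 : k = 1 := Nat.eq_one_of_mul_eq_one_left (by exact_mod_cast h5)
    rw [h3, h6]
    simp
  -- Rescaling each component by `2 / t` turns the lengths `k t` into `2 k`, that is 2, 4, 6 or 8.
  -- At imaginary roots `t` is an arbitrary default, so `q` is set to 0 there.
  let q : R.roots → K := fun α => if R.s α ≠ 1 then 2 * b α α / t α else 0
  have hq : ∀ α, R.s α ≠ 1 → q α = 2 * b α α / t α := fun α h => if_pos h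
  obtain ⟨b', hb', hbq⟩ := R.exists_affineForm_of_symmetrizer q (fun α β => by
    by_cases h : R.coroot α (β : X) = 0
    · rw [h, hb.coroot_apply_eq_zero_comm h, mul_zero, mul_zero]
    · have hα := R.real_of_coroot_apply_ne_zero h
      have hc : R.ConnectedRoots α β := Relation.ReflTransGen.single h
      have hβ := hb.real_of_connectedRoots hc hα
      rw [hq α hα, hq β hβ, ← ht α β hα hc]
      linear_combination 2 / t α * hb.symmetrizes α β)
    (fun α hα => by
      rw [hq α hα]
      exact div_ne_zero (mul_ne_zero two_ne_zero (hb.apply_self_ne_zero hα)) (ht0 α hα))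
  have hb'q : ∀ α : R.roots, R.s α ≠ 1 → b' α α = 2 * b α α / t α := by
    intro α hα
    rw [hbq, R.coroot_self hα, hq α hα]
    ring
  refine ⟨b', hb', ?_⟩
  rintro _ ⟨α, hα, rfl⟩
  rw [mem_realRoots_iff] at hα
  constructor
  · obtain ⟨β, hβ, h⟩ := hmin α hα
    refine (hb'.mem_squareLengths_iff hα).2 ⟨β, hβ, ?_⟩
    rw [hb'q β (hb.real_of_connectedRoots hβ hα), h, ← ht α β hα hβ,
      mul_div_cancel_right₀ _ (ht0 α hα)]
  · intro s hs
    obtain ⟨β, hβ, rfl⟩ := (hb'.mem_squareLengths_iff hα).1 hs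
    obtain ⟨k, hk1, hk4, hk⟩ := hle α hα β hβ
    rw [hb'q β (hb.real_of_connectedRoots hβ hα), hk, ← ht α β hα hβ, ← mul_assoc,
      mul_div_cancel_right₀ _ (ht0 α hα)]
    interval_cases k <;> norm_num

/-- For neighbours the ratio of lengths is a ratio of pairings, whatever the form; hence two affine
forms are proportional on a component. -/
theorem IsAffineForm.apply_self_mul_apply_self (hb : R.IsAffineForm b) (hb' : R.IsAffineForm b')
    {α β : R.roots} (h : R.ConnectedRoots α β) : b β β * b' α α = b' β β * b α α := by
  induction h with
  | refl => ring
  | @tail β γ _ h ih =>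
    refine mul_right_cancel₀ (fun h' => h (hb.coroot_apply_eq_zero_comm h') :
      R.coroot γ (β : X) ≠ 0) ?_
    linear_combination b' α α * hb.symmetrizes β γ - b α α * hb'.symmetrizes β γ +
      R.coroot β γ * ih

theorem IsNormalized.exists_apply_self_eq_two (hb : R.IsAffineForm b) (hn : R.IsNormalized b)
    {α : R.roots} (hα : R.s α ≠ 1) : ∃ β, R.ConnectedRoots α β ∧ b β β = 2 :=
  (hb.mem_squareLengths_iff hα).1 (hn _ ⟨α, (R.mem_realRoots_iff α).2 hα, rfl⟩).1

theorem IsNormalized.apply_self_mem (hb : R.IsAffineForm b) (hn : R.IsNormalized b)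
    {α : R.roots} (hα : R.s α ≠ 1) : b α α ∈ ({2, 3, 4, 6, 8} : Set K) :=
  (hn _ ⟨α, (R.mem_realRoots_iff α).2 hα, rfl⟩).2
    ((hb.mem_squareLengths_iff hα).2 ⟨α, Relation.ReflTransGen.refl, rfl⟩)

theorem IsNormalized.eq (hb : R.IsAffineForm b) (hb' : R.IsAffineForm b')
    (hn : R.IsNormalized b) (hn' : R.IsNormalized b') : b = b' := by
  have key : ∀ α : R.roots, b α α = b' α α := by
    intro α
    by_cases hα : R.s α = 1
    · rw [LinearMap.mem_ker.1 (hb.mem_ker_of_eq_one hα),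
        LinearMap.mem_ker.1 (hb'.mem_ker_of_eq_one hα)]
    obtain ⟨β, hβ, h1⟩ := hn.exists_apply_self_eq_two hb hα
    obtain ⟨γ, hγ, h2⟩ := hn'.exists_apply_self_eq_two hb' hα
    have h3 := hb.apply_self_mul_apply_self hb' ((hb.connectedRoots_symm hβ).trans hγ)
    have h4 := hn.apply_self_mem hb (hb.real_of_connectedRoots hγ hα)
    have h5 := hn'.apply_self_mem hb' (hb.real_of_connectedRoots hβ hα)
    have h6 := hb.apply_self_mul_apply_self hb' hβ
    rw [h1, h2] at h3
    rw [h1] at h6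
    -- Proportionality gives `b(γ, γ) b'(β, β) = 4`, and in `{2, 3, 4, 6, 8}` only `2 · 2` has
    -- product 4.
    have h7 : b' β β = 2 := by
      simp only [Set.mem_insert_iff, Set.mem_singleton_iff] at h4 h5
      rcases h4 with h4 | h4 | h4 | h4 | h4 <;> rcases h5 with h5 | h5 | h5 | h5 | h5 <;>
        rw [h4, h5] at h3 <;> first | exact h5 | (exfalso; norm_num at h3)
    rw [h7] at h6
    exact (mul_left_cancel₀ two_ne_zero h6).symm
  refine LinearMap.ext fun x => R.linearMap_ext fun α => ?_
  refine mul_left_cancel₀ (two_ne_zero (α := K)) ?_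
  rw [hb.two_mul_apply, hb'.two_mul_apply, key]

/-- The ratios 3 : 2, 6 : 4 and 8 : 6 are not integral, which excludes 3 altogether and 6 in the
company of 4 or 8. -/
theorem mem_squareLength_sets {L : Set K} (h2 : 2 ∈ L) (hL : L ⊆ {2, 3, 4, 6, 8})
    (hr : ∀ s ∈ L, ∀ t ∈ L, ∃ k : ℕ, 1 ≤ k ∧ k ≤ 4 ∧ (t = k * s ∨ s = k * t)) :
    L ∈ ({{2}, {2, 4}, {2, 6}, {2, 8}, {2, 4, 8}} : Set (Set K)) := by
  have hr' : ∀ m n : ℕ, (m : K) ∈ L → (n : K) ∈ L →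
      ∃ k : ℕ, 1 ≤ k ∧ k ≤ 4 ∧ (n = k * m ∨ m = k * n) := by
    intro m n hm hn
    obtain ⟨k, h1, h4, h⟩ := hr _ hm _ hn
    exact ⟨k, h1, h4, by exact_mod_cast h⟩
  have h3 : (3 : K) ∉ L := fun h => by
    obtain ⟨k, h1, h4, h⟩ := hr' 2 3 (by exact_mod_cast h2) (by exact_mod_cast h)
    omega
  have h46 : (4 : K) ∈ L → (6 : K) ∉ L := fun h h' => by
    obtain ⟨k, h1, h4, h⟩ := hr' 4 6 (by exact_mod_cast h) (by exact_mod_cast h')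
    omega
  have h68 : (6 : K) ∈ L → (8 : K) ∉ L := fun h h' => by
    obtain ⟨k, h1, h4, h⟩ := hr' 6 8 (by exact_mod_cast h) (by exact_mod_cast h')
    omega
  have hx : ∀ x ∈ L, x = 2 ∨ x = 4 ∨ x = 6 ∨ x = 8 := by
    intro x hx
    rcases hL hx with rfl | rfl | rfl | rfl | h
    · simp
    · exact absurd hx h3
    · simp
    · simp
    · exact Or.inr (Or.inr (Or.inr h))
  simp only [Set.mem_insert_iff, Set.mem_singleton_iff]
  by_cases h6 : (6 : K) ∈ L
  · refine Or.inr (Or.inr (Or.inl (Set.Subset.antisymm (fun x hxL => ?_) ?_)))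
    · rcases hx x hxL with rfl | rfl | rfl | rfl
      · simp
      · exact absurd h6 (h46 hxL)
      · simp
      · exact absurd hxL (h68 h6)
    · rintro x (rfl | rfl) <;> assumption
  · have hx' : ∀ x ∈ L, x = 2 ∨ x = 4 ∨ x = 8 := by
      intro x hxL
      rcases hx x hxL with rfl | rfl | rfl | rfl
      · simp
      · simp
      · exact absurd hxL h6
      · simp
    by_cases h4 : (4 : K) ∈ L <;> by_cases h8 : (8 : K) ∈ L
    · refine Or.inr (Or.inr (Or.inr (Or.inr (Set.Subset.antisymm (fun x hxL => hx' x hxL) ?_))))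
      rintro x (rfl | rfl | rfl) <;> assumption
    · refine Or.inr (Or.inl (Set.Subset.antisymm (fun x hxL => ?_) ?_))
      · rcases hx' x hxL with rfl | rfl | rfl
        · simp
        · simp
        · exact absurd hxL h8
      · rintro x (rfl | rfl) <;> assumption
    · refine Or.inr (Or.inr (Or.inr (Or.inl (Set.Subset.antisymm (fun x hxL => ?_) ?_))))
      · rcases hx' x hxL with rfl | rfl | rfl
        · simp
        · exact absurd hxL h4
        · simp
      · rintro x (rfl | rfl) <;> assumption
    · refine Or.inl (Set.Subset.antisymm (fun x hxL => ?_) ?_)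
      · rcases hx' x hxL with rfl | rfl | rfl
        · simp
        · exact absurd hxL h4
        · exact absurd hxL h8
      · rintro x rfl
        assumption

theorem IsExtension.squareLengths_mem (hf : R.IsExtension S f)
    (hS : S.IsLocallyFiniteRootSystem) (hb : R.IsAffineForm b) (hn : R.IsNormalized b)
    {C : Set X} (hC : R.IsConnectedComponent C) :
    squareLengths b C ∈ ({{2}, {2, 4}, {2, 6}, {2, 8}, {2, 4, 8}} : Set (Set K)) := by
  refine mem_squareLength_sets (hn C hC).1 (hn C hC).2 ?_
  obtain ⟨α, hα, rfl⟩ := hC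
  rw [mem_realRoots_iff] at hα
  intro s hs t ht
  obtain ⟨β, hβ, rfl⟩ := (hb.mem_squareLengths_iff hα).1 hs
  obtain ⟨γ, hγ, rfl⟩ := (hb.mem_squareLengths_iff hα).1 ht
  exact hf.squareLength_ratio hS hb (hb.real_of_connectedRoots hβ hα)
    ((hb.connectedRoots_symm hβ).trans hγ)

theorem IsExtension.apply_self_nonneg (hf : R.IsExtension S f)
    (hS : S.IsLocallyFiniteRootSystem) (hb : R.IsAffineForm b) (hn : R.IsNormalized b)
    (e : K ≃+* ℝ) (x : X) : 0 ≤ e (b x x) := by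
  -- The decomposition holds only in the quotient. Its lift `y` differs from `x` by an element of
  -- `Ker f = Rad b`, so `b x = b y`, and `2 b(x, x)` becomes a sum of squares weighted by `d γ` and
  -- square lengths, all nonnegative in `ℝ`.
  obtain ⟨F, d, hd, hx⟩ := hS.exists_eq_sum_coroot_smul (f x)
  choose g hg using hf.exists_map_eq
  let y : X := ∑ γ ∈ F, ((d γ : K) * R.coroot (g γ) x) • (g γ : X)
  have hy : f y = f x := by
    rw [hx, map_sum]
    refine Finset.sum_congr rfl fun γ _ => ?_
    rw [map_smul, ← hf.coroot_map, hg, ← hf.coe_map, hg]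
  have hxy : b x = b y := by
    rw [← sub_eq_zero, ← map_sub]
    have : x - y ∈ LinearMap.ker f := by rw [LinearMap.mem_ker, map_sub, hy, sub_self]
    rwa [← hf.ker_eq_ker hS hb] at this
  have h2 : 2 * b x x =
      ∑ γ ∈ F, (d γ : K) * (R.coroot (g γ) x * R.coroot (g γ) x * b (g γ) (g γ)) := by
    rw [hb.apply_comm]
    nth_rw 1 [hxy]
    rw [map_sum, LinearMap.sum_apply, Finset.mul_sum]
    refine Finset.sum_congr rfl fun γ _ => ?_
    rw [map_smul, LinearMap.smul_apply, hb.apply_comm, smul_eq_mul]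
    linear_combination (d γ : K) * R.coroot (g γ) x * hb.two_mul_apply (g γ) x
  have hpos : ∀ α : R.roots, 0 ≤ e (b α α) := by
    intro α
    by_cases hα : R.s α = 1
    · simp [LinearMap.mem_ker.1 (hb.mem_ker_of_eq_one hα)]
    · rcases hn.apply_self_mem hb hα with h | h | h | h | h <;> rw [h, map_ofNat] <;> positivity
  have h3 := congrArg e h2
  rw [map_mul, map_ofNat, map_sum] at h3
  have h4 : 0 ≤ 2 * e (b x x) := by
    rw [h3]
    refine Finset.sum_nonneg fun γ _ => ?_
    rw [map_mul, map_mul, map_mul, map_ratCast]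
    exact mul_nonneg (by exact_mod_cast hd γ) (mul_nonneg (mul_self_nonneg _) (hpos _))
  linarith

end Normalized

theorem IsAffineForm.existsUnique_isomorphism {K : Type u} {X : Type v} {Y : Type w} [Field K]
    [CharZero K] [AddCommGroup X] [Module K X] [AddCommGroup Y] [Module K Y]
    {R : PreReflectionSystem K X} {b : LinearMap.BilinForm K X} (hb : R.IsAffineForm b)
    {S : PreReflectionSystem K Y} {f : X →ₗ[K] Y} (hf : R.IsQuotientRootSystem S f) :
    ∃! e : (X ⧸ LinearMap.ker b) ≃ₗ[K] Y, hb.quotientSystem.IsIsomorphism S e ∧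
      (e : (X ⧸ LinearMap.ker b) →ₗ[K] Y) ∘ₗ (LinearMap.ker b).mkQ = f := by
  obtain ⟨hS, hf⟩ := hf
  let e : (X ⧸ LinearMap.ker b) ≃ₗ[K] Y :=
    (Submodule.quotEquivOfEq _ _ (hf.ker_eq_ker hS hb)).trans
      (f.quotKerEquivOfSurjective hf.surjective)
  have he : ∀ x, e ((LinearMap.ker b).mkQ x) = f x := fun x => rfl
  refine ⟨e, ⟨isIsomorphism_of_comp hb.isExtension_mkQ hf e he, LinearMap.ext he⟩, ?_⟩
  rintro e' ⟨-, he'⟩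
  ext y
  obtain ⟨x, rfl⟩ := (LinearMap.ker b).mkQ_surjective y
  rw [he]
  exact LinearMap.congr_fun he' x

end PreReflectionSystem

theorem mainTheorem7 {K : Type u} {X : Type v} [Field K] [CharZero K] [AddCommGroup X]
    [Module K X] (R : PreReflectionSystem K X) :
    (R.IsAffineReflectionSystem ↔
      R.IsIntegral ∧ (∃ b : LinearMap.BilinForm K X, R.IsAffineForm b) ∧
        R.HasBoundedCorootValues) ∧
    (R.IsAffineReflectionSystem →
      -- (a): `X / Rad b` carries the quotient root system, and the canonical map is its projection
      (∀ b : LinearMap.BilinForm K X, R.IsAffineForm b →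
        ∃ S : PreReflectionSystem K (X ⧸ LinearMap.ker b),
          S.roots = (LinearMap.ker b).mkQ '' R.roots ∧
          R.IsQuotientRootSystem S (LinearMap.ker b).mkQ ∧
          -- it is the only one, up to a unique isomorphism
          (∀ (Y : Type v) [AddCommGroup Y] [Module K Y] (S' : PreReflectionSystem K Y)
            (f' : X →ₗ[K] Y), R.IsQuotientRootSystem S' f' →
              ∃! e : (X ⧸ LinearMap.ker b) ≃ₗ[K] Y,
                S.IsIsomorphism S' e ∧ (e : (X ⧸ LinearMap.ker b) →ₗ[K] Y) ∘ₗ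
                  (LinearMap.ker b).mkQ = f') ∧
          (R.RealPartConnected ↔ S.IsIrreducible)) ∧
      -- (b): the normalized affine form
      (∃! b : LinearMap.BilinForm K X, R.IsAffineForm b ∧ R.IsNormalized b) ∧
      (∀ b : LinearMap.BilinForm K X, R.IsAffineForm b → R.IsNormalized b →
        (∀ C : Set X, R.IsConnectedComponent C →
          PreReflectionSystem.squareLengths b C ∈
            ({{2}, {2, 4}, {2, 6}, {2, 8}, {2, 4, 8}} : Set (Set K))) ∧
        (∀ (Y : Type v) [AddCommGroup Y] [Module K Y] (S : PreReflectionSystem K Y)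
          (f : X →ₗ[K] Y), R.IsQuotientRootSystem S f → LinearMap.ker b = LinearMap.ker f) ∧
        -- for `K = ℝ`, the form is positive semidefinite
        (∀ (e : K ≃+* ℝ) (x : X), 0 ≤ e (b x x)))) := by
  have hiff : R.IsAffineReflectionSystem ↔ R.IsIntegral ∧
      (∃ b : LinearMap.BilinForm K X, R.IsAffineForm b) ∧ R.HasBoundedCorootValues := by
    constructor
    · rintro ⟨Y, _, _, S, f, hS, hf⟩
      exact ⟨hf.isIntegral hS.1, hf.exists_affineForm hS, hf.hasBoundedCorootValues hS⟩
    · rintro ⟨hI, ⟨b, hb⟩, hB⟩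
      exact ⟨_, _, _, hb.quotientSystem, _, hb.isLocallyFinite_quotientSystem hI hB,
        hb.isExtension_mkQ⟩
  refine ⟨hiff, fun hR => ⟨fun b hb => ?_, ?_, fun b hb hn => ⟨fun C hC => ?_, ?_, ?_⟩⟩⟩
  · obtain ⟨hI, -, hB⟩ := hiff.1 hR
    have hS := hb.isLocallyFinite_quotientSystem hI hB
    exact ⟨hb.quotientSystem, rfl, ⟨hS, hb.isExtension_mkQ⟩,
      fun Y _ _ S' f' hf' => hb.existsUnique_isomorphism hf',
      hb.isExtension_mkQ.realPartConnected_iff.trans hS.realPartConnected_iff_isIrreducible⟩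
  · obtain ⟨Y, _, _, S, f, hS, hf⟩ := hR
    obtain ⟨b, hb, hn⟩ := hf.exists_normalized hS
    exact ⟨b, ⟨hb, hn⟩, fun b' h => PreReflectionSystem.IsNormalized.eq h.1 hb h.2 hn⟩
  · obtain ⟨Y, _, _, S, f, hS, hf⟩ := hR
    exact hf.squareLengths_mem hS hb hn hC
  · intro Y _ _ S f hf
    exact hf.2.ker_eq_ker hf.1 hb
  · obtain ⟨Y, _, _, S, f, hS, hf⟩ := hR
    exact hf.apply_self_nonneg hS hb hn
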